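/- **Notation and definitions.** For a category $\mathscr C$, the 2-path-category $\mathscr P_{\mathscr C}$ has the objects of $\mathscr C$ as objects. Its 1-cells $A\to B$ are the paths $[n,s]$, $s=(A=A_0\to A_1\to\dots\to A_n=B)$, $n\ge 0$, of arrows of $\mathscr C$ (with $[0,A]$ the identity of $A$), composed by concatenation $s\ast t$ (first $s$, then $t$). A 2-cell $[n,s]\to[m,t]$ is a nondecreasing map $u:\{0,\dots,n-1\}\to\{0,\dots,m-1\}$ that sends $s$ to $t$, where $u$ acts by composing the arrows of $s$ lying in each fibre of $u$ and inserting an identity for each empty fibre; 2-cells are concatenated by ordinal sum. A *base* $(\mathscr M,\mathscr W)$ is a bicategory $\mathscr M$ with a class $\mathscr W$ of 2-cells which contains all invertible 2-cells, has the vertical "3 out of 2" property and is stable under horizontal composition. A *$\mathscr C$-point* of $(\mathscr M,\mathscr W)$ is a colax morphism of bicategories $F:\mathscr P_{\mathscr C}\to\mathscr M$ all of whose colaxity 2-cells $\varphi_{s,t}:F(s\ast t)\to F(s)\otimes F(t)$ and $\varphi_A:F([0,A])\to I$ are in $\mathscr W$. A monoidal category $(\mathscr M,\otimes,I)$ is identified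 with the bicategory with one object whose 1-cells are the objects of $\mathscr M$, where the composite of a path of two 1-cells $X$, $Y$ is $X\otimes Y$. A morphism $F\to G$ of $\mathscr C$-points of a monoidal base is a transformation of colax morphisms whose 1-cell components are identities, i.e. a family of morphisms $\sigma_s:F(s)\to G(s)$, natural in $s$ and compatible with the colaxity maps. Let $\mathbf 1$ be the category with one object and only its identity, and write $[n]$ for the unique path of length $n$ in $\mathbf 1$. Let $\Delta$ be the category of all finite ordinals $n=\{0,\dots,n-1\}$, including $0$, and nondecreasing maps, monoidal under ordinal sum $(+,0)$, and $\Delta^+$ its full subcategory of nonempty ordinals. For a base $(\mathscr M,\mathscr W)$ with $\mathscr M$ monoidal, an *up-to-homotopy monoid* in the sense of Leinster is a colax monoidal functor $(Y,\xi):(\Delta,+,0)\to\mathscr M$ whose colaxity maps $\xi_{mn}:Y(m+n)\to Y(m)\otimes Y(n)$ and $\xi_0:Y(0)\to I$ are in $\mathscr W$; morphisms are monoidal natural transformations. **Proposition.** 1. Let $\mathscr M$ be a monoidal category. The category of $\mathbf 1$-points of $(\mathscr M,\mathrm{Iso}(\mathscr M))$ is equivalent to the category of monoids in $\mathscr M$.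 The monoid corresponding to $F$ is, naturally in $F$, the object $F([1])$ with unit $I\xrightarrow{\varphi^{-1}}F([0])\to F([1])$ and multiplication $F([1])\otimes F([1])\xrightarrow{\varphi^{-1}}F([2])\to F([1])$, the second maps being the images of the unique maps $0\to1$ and $2\to 1$ of $\Delta$. 2. Let $\mathscr M$ be a monoidal category and $\mathscr W$ a class of morphisms such that $(\mathscr M,\mathscr W)$ is a base. The category of $\mathbf 1$-points of $(\mathscr M,\mathscr W)$ is equivalent to the category of up-to-homotopy monoids of $(\mathscr M,\mathscr W)$. If $Y$ corresponds to $F$, then $Y(n)\cong F([n])$ naturally in $n\in\Delta$ and in $F$, and this identifies the colaxity maps of $Y$ with those of $F$. 3. Let $\mathscr M$ be a category with finite products, regarded as a monoidal category for the cartesian product. The category of $\mathbf 1$-points of $(\mathscr M,\mathrm{Mor}(\mathscr M))$ is equivalent to the category of simplicial objects $X:(\Delta^+)^{op}\to\mathscr M$. If $X$ corresponds to $F$, then $X_n\cong F([n])$ naturally in $F$, where $X_n$ is the value of $X$ at the ordinal with $n+1$ elements $\{0,\dots,n\}$ (the set of vertices of the path $[n]$). Under these isomorphisms, for $u:n\to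 m$ in $\Delta$ the map $F(u)$ is the value of $X$ at the dual map $\{0,\dots,m\}\to\{0,\dots,n\}$, $j\mapsto\#\{i : u(i)<j\}$, and the components of $\varphi:F([m+n])\to F([m])\times F([n])$ are the values of $X$ at the inclusions of $\{0,\dots,m\}$ and $\{0,\dots,n\}$ as the initial and the final segment of $\{0,\dots,m+n\}$. -/

import Mathlib

open CategoryTheory MonoidalCategory Opposite

universe w v u w₁ v₁ u₁

namespace SegalPath

/-! ### Monotone maps of finite ordinals and their cuts -/

/-- For a map `u : n → m` of finite ordinals and `j ≤ m`, the number of elements of `n` that `u`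
sends below `j`. As `u` is monotone, the fibre of `u` over `k < m` consists exactly of the
elements `i` with `cut u k ≤ i < cut u (k + 1)`. -/
def cut {n m : ℕ} (u : Fin n →o Fin m) (j : ℕ) : ℕ :=
  (Finset.univ.filter fun i : Fin n => (u i : ℕ) < j).card

lemma cut_le {n m : ℕ} (u : Fin n →o Fin m) (j : ℕ) : cut u j ≤ n :=
  (Finset.card_le_univ _).trans_eq (Fintype.card_fin n)

lemma lt_cut_iff {n m : ℕ} (u : Fin n →o Fin m) (j : ℕ) (i : Fin n) :
    (i : ℕ) < cut u j ↔ (u i : ℕ) < j := by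
  constructor
  · intro h
    by_contra h'
    have hsub : (Finset.univ.filter fun i : Fin n => (u i : ℕ) < j) ⊆ Finset.Iio i := by
      intro k hk
      simp only [Finset.mem_filter, Finset.mem_univ, true_and] at hk
      rw [Finset.mem_Iio]
      by_contra hik
      have : (u i : ℕ) ≤ u k := u.monotone (not_lt.mp hik)
      omega
    have hcard := Finset.card_le_card hsub
    rw [Fin.card_Iio] at hcard
    unfold cut at h
    omega
  · intro h
    have hsub : Finset.Iic i ⊆ (Finset.univ.filter fun i : Fin n => (u i : ℕ) < j) := by
      intro k hk
      rw [Finset.mem_Iic] at hk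
      have : (u k : ℕ) ≤ u i := u.monotone hk
      simp only [Finset.mem_filter, Finset.mem_univ, true_and]
      omega
    have hcard := Finset.card_le_card hsub
    rw [Fin.card_Iic] at hcard
    unfold cut
    omega

lemma cut_eq {n m : ℕ} (u : Fin n →o Fin m) (j c : ℕ) (hc : c ≤ n)
    (h : ∀ i : Fin n, (i : ℕ) < c ↔ (u i : ℕ) < j) : cut u j = c := by
  apply le_antisymm
  · by_contra hlt
    have h1 := cut_le u j
    have := (lt_cut_iff u j ⟨c, by omega⟩).1 (by simpa using hlt)
    have := (h ⟨c, by omega⟩).2 this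
    simp at this
  · by_contra hlt
    have := (h ⟨cut u j, by omega⟩).1 (by simpa using hlt)
    have := (lt_cut_iff u j ⟨cut u j, by omega⟩).2 this
    simp at this

lemma cut_mono {n m : ℕ} (u : Fin n →o Fin m) {j k : ℕ} (h : j ≤ k) : cut u j ≤ cut u k :=
  Finset.card_le_card (Finset.monotone_filter_right _ fun _ _ hi => lt_of_lt_of_le hi h)

/-! ### Paths in a category and the 2-path-category -/

section Paths

variable {C : Type u} [Category.{v} C]

/-- The composite of the path `s` between its `i`-th and its `j`-th vertex is `f : X ⟶ Y`. -/
def HasSegment {A B : C} (s : Quiver.Path A B) (i j : ℕ) {X Y : C} (f : X ⟶ Y) : Prop :=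
  ∃ (p : Quiver.Path A X) (q : Quiver.Path X Y) (r : Quiver.Path Y B),
    s = p.comp (q.comp r) ∧ p.length = i ∧ p.length + q.length = j ∧ composePath q = f

/-- A 2-cell `[n, s] ⟶ [m, t]` between two paths from `A` to `B`: a nondecreasing map `u : n → m`
whose action on paths (compose the arrows of `s` in every fibre of `u`, insert an identity over
every element outside the image of `u`) sends `s` to `t`. Equivalently, the composite of `t`
between any two of its vertices `j ≤ k` is the composite of `s` between its vertices
`cut u j ≤ cut u k`. -/
@[ext]
structure Cell {A B : C} (s t : Quiver.Path A B) where
  map : Fin s.length →o Fin t.length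
  segment : ∀ (j k : ℕ) {X Y : C} (f : X ⟶ Y),
    HasSegment t j k f → HasSegment s (cut map j) (cut map k) f

lemma HasSegment.le {A B : C} {s : Quiver.Path A B} {i j : ℕ} {X Y : C} {f : X ⟶ Y}
    (h : HasSegment s i j f) : i ≤ j ∧ j ≤ s.length := by
  obtain ⟨p, q, r, rfl, rfl, rfl, rfl⟩ := h
  simp only [Quiver.Path.length_comp]
  omega

lemma Cell.ext' {A B : C} {s t : Quiver.Path A B} {α β : Cell s t}
    (h : ∀ i, (α.map i : ℕ) = β.map i) : α = β :=
  Cell.ext (OrderHom.ext _ _ (funext fun i => Fin.ext (h i)))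

/-- The paths from `A` to `B` form the category of elements of the cosimplicial set of paths. -/
instance pathCategory (A B : C) : Category (Quiver.Path A B) where
  Hom s t := Cell s t
  id s :=
    { map := OrderHom.id
      segment := fun j k X Y f h => by
        have := h.le
        rwa [cut_eq _ j j (by omega) (fun i => Iff.rfl), cut_eq _ k k (by omega) (fun i => Iff.rfl)] }
  comp {s t r} α β :=
    { map := β.map.comp α.map
      segment := fun j k X Y f h => by
        have key : ∀ j, cut (β.map.comp α.map) j = cut α.map (cut β.map j) := fun j =>
          cut_eq _ _ _ (cut_le _ _) fun i => by
            rw [lt_cut_iff, lt_cut_iff]; rfl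
        rw [key, key]
        exact α.segment _ _ _ (β.segment _ _ _ h) }

@[simp] lemma id_map {A B : C} (s : Quiver.Path A B) (i) : Cell.map (𝟙 s) i = i := rfl

@[simp] lemma comp_map {A B : C} {s t r : Quiver.Path A B} (α : s ⟶ t) (β : t ⟶ r) (i) :
    Cell.map (α ≫ β) i = β.map (α.map i) := rfl

lemma eqToHom_map {A B : C} {s t : Quiver.Path A B} (h : s = t) (i) :
    (Cell.map (eqToHom h) i : ℕ) = i := by
  subst h; rfl

lemma exists_of_comp_eq {A B X Y : C} {p : Quiver.Path A X} {q : Quiver.Path X B}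
    {p' : Quiver.Path A Y} {q' : Quiver.Path Y B} (h : p.comp q = p'.comp q')
    (hle : p.length ≤ p'.length) : ∃ d : Quiver.Path X Y, p' = p.comp d ∧ q = d.comp q' := by
  induction q' with
  | nil => exact ⟨q, h.symm, rfl⟩
  | cons q'' e ih =>
    cases q with
    | nil =>
      have := congrArg Quiver.Path.length h
      simp at this
      omega
    | cons q₁ e₁ =>
      simp only [Quiver.Path.comp_cons, Quiver.Path.cons.injEq] at h
      obtain ⟨rfl, h2, h3⟩ := h
      obtain rfl := eq_of_heq h3
      obtain ⟨d, hd, rfl⟩ := ih (eq_of_heq h2)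
      exact ⟨d, hd, rfl⟩

lemma HasSegment.comp_left {A B D : C} {s : Quiver.Path A B} (r : Quiver.Path B D) {i j : ℕ}
    {X Y : C} {f : X ⟶ Y} (h : HasSegment s i j f) : HasSegment (s.comp r) i j f := by
  obtain ⟨p, q, r', rfl, rfl, rfl, rfl⟩ := h
  exact ⟨p, q, r'.comp r, by simp, rfl, rfl, rfl⟩

lemma HasSegment.comp_right {A B D : C} (r : Quiver.Path A B) {s : Quiver.Path B D} {i j : ℕ}
    {X Y : C} {f : X ⟶ Y} (h : HasSegment s i j f) :
    HasSegment (r.comp s) (r.length + i) (r.length + j) f := by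
  obtain ⟨p, q, r', rfl, rfl, rfl, rfl⟩ := h
  exact ⟨r.comp p, q, r', by simp, by simp, by simp; omega, rfl⟩

lemma HasSegment.glue {A B D X Y : C} {s : Quiver.Path A B} {t : Quiver.Path B D} {i j : ℕ}
    {f : X ⟶ B} {g : B ⟶ Y} (h : HasSegment s i s.length f) (h' : HasSegment t 0 j g) :
    HasSegment (s.comp t) i (s.length + j) (f ≫ g) := by
  obtain ⟨p, q, r, rfl, rfl, hl, rfl⟩ := h
  obtain ⟨p', q', r', rfl, hp', rfl, rfl⟩ := h'
  simp only [Quiver.Path.length_comp] at hl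
  obtain rfl := Quiver.Path.eq_nil_of_length_zero r (by omega)
  cases p' with
  | nil => exact ⟨p, q.comp q', r', by simp, rfl, by simp; omega, by simp⟩
  | cons p'' e => simp at hp'

lemma segment_toPath {A B : C} {e : A ⟶ B} (P : ∀ (_ _ : ℕ) {X Y : C} (_ : X ⟶ Y), Prop)
    (h₀ : P 0 0 (𝟙 A)) (h : P 0 1 e) (h₁ : P 1 1 (𝟙 B)) (j k : ℕ) {X Y : C} (f : X ⟶ Y)
    (hf : HasSegment e.toPath j k f) : P j k f := by
  obtain ⟨p, q, r, hp, rfl, rfl, rfl⟩ := hf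
  cases r with
  | nil =>
    cases q with
    | nil => obtain rfl : e.toPath = p := hp; exact h₁
    | cons q e' =>
      simp only [Quiver.Hom.toPath, Quiver.Path.comp_nil, Quiver.Path.comp_cons,
        Quiver.Path.cons.injEq] at hp
      obtain ⟨rfl, h2, h3⟩ := hp
      obtain rfl := eq_of_heq h3
      cases q with
      | nil => obtain rfl := eq_of_heq h2; simpa using h
      | cons q e'' => simpa using congrArg Quiver.Path.length (eq_of_heq h2)
  | cons r e' =>
    simp only [Quiver.Hom.toPath, Quiver.Path.comp_cons, Quiver.Path.cons.injEq] at hp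
    obtain ⟨rfl, h2, h3⟩ := hp
    obtain rfl := eq_of_heq h3
    cases r with
    | nil =>
      cases q with
      | nil => obtain rfl := eq_of_heq h2; exact h₀
      | cons q e'' => simpa using congrArg Quiver.Path.length (eq_of_heq h2)
    | cons r e'' => simpa using congrArg Quiver.Path.length (eq_of_heq h2)

/-- The ordinal sum of two nondecreasing maps, first `u`, then `u'`. -/
def ordinalSum {n n' m m' N M : ℕ} (u : Fin n →o Fin m) (u' : Fin n' →o Fin m')
    (hN : N = n + n') (hM : M = m + m') : Fin N →o Fin M where
  toFun i := if h : (i : ℕ) < n then ⟨u ⟨i, h⟩, by have := (u ⟨i, h⟩).2; omega⟩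
    else ⟨m + u' ⟨i - n, by have := i.2; omega⟩, by
      have := (u' ⟨i - n, by have := i.2; omega⟩).2; omega⟩
  monotone' i j hij := by
    rw [Fin.le_def] at hij ⊢
    dsimp only
    split_ifs with h1 h2 h2
    · exact u.monotone (show (⟨i, h1⟩ : Fin n) ≤ ⟨j, h2⟩ from hij)
    · have := (u ⟨i, h1⟩).2
      simp only
      omega
    · omega
    · have := u'.monotone (show (⟨i - n, by have := i.2; omega⟩ : Fin n') ≤
        ⟨j - n, by have := j.2; omega⟩ from Nat.sub_le_sub_right hij n)
      rw [Fin.le_def] at this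
      simp only
      omega

lemma ordinalSum_left {n n' m m' N M : ℕ} (u : Fin n →o Fin m) (u' : Fin n' →o Fin m')
    (hN : N = n + n') (hM : M = m + m') (i : Fin N) (h : (i : ℕ) < n) :
    (ordinalSum u u' hN hM i : ℕ) = u ⟨i, h⟩ :=
  congrArg Fin.val (dif_pos h)

lemma ordinalSum_right {n n' m m' N M : ℕ} (u : Fin n →o Fin m) (u' : Fin n' →o Fin m')
    (hN : N = n + n') (hM : M = m + m') (i : Fin N) (h : ¬ (i : ℕ) < n) :
    (ordinalSum u u' hN hM i : ℕ) = m + u' ⟨i - n, by have := i.2; omega⟩ :=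
  congrArg Fin.val (dif_neg h)

lemma cut_ordinalSum_left {n n' m m' N M : ℕ} (u : Fin n →o Fin m) (u' : Fin n' →o Fin m')
    (hN : N = n + n') (hM : M = m + m') (j : ℕ) (hj : j ≤ m) :
    cut (ordinalSum u u' hN hM) j = cut u j := by
  have hc := cut_le u j
  refine cut_eq _ _ _ (by omega) fun i => ?_
  by_cases h : (i : ℕ) < n
  · rw [ordinalSum_left _ _ _ _ _ h, ← lt_cut_iff]
  · rw [ordinalSum_right _ _ _ _ _ h]
    omega

lemma cut_ordinalSum_right {n n' m m' N M : ℕ} (u : Fin n →o Fin m) (u' : Fin n' →o Fin m')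
    (hN : N = n + n') (hM : M = m + m') (j : ℕ) :
    cut (ordinalSum u u' hN hM) (m + j) = n + cut u' j := by
  have hc := cut_le u' j
  refine cut_eq _ _ _ (by omega) fun i => ?_
  by_cases h : (i : ℕ) < n
  · rw [ordinalSum_left _ _ _ _ _ h]
    have := (u ⟨i, h⟩).2
    omega
  · rw [ordinalSum_right _ _ _ _ _ h]
    have := lt_cut_iff u' j ⟨i - n, by have := i.2; omega⟩
    simp only at this
    omega

/-- Concatenation of 2-cells: the ordinal sum of the underlying maps. -/
def hcomp {A B D : C} {s t : Quiver.Path A B} {s' t' : Quiver.Path B D} (α : s ⟶ t) (β : s' ⟶ t') :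
    s.comp s' ⟶ t.comp t' where
  map := ordinalSum α.map β.map (Quiver.Path.length_comp s s') (Quiver.Path.length_comp t t')
  segment := by
    have hend : ∀ {n m : ℕ} (u : Fin n →o Fin m), cut u m = n := fun {n m} u =>
      cut_eq _ _ _ le_rfl fun i => ⟨fun _ => (u i).2, fun _ => i.2⟩
    have hzero : ∀ {n m : ℕ} (u : Fin n →o Fin m), cut u 0 = 0 := fun {n m} u =>
      cut_eq _ _ _ (Nat.zero_le _) fun i => by simp
    intro j k X Y f hf
    obtain ⟨p, q, r, h, rfl, rfl, rfl⟩ := hf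
    by_cases h1 : t.length ≤ p.length
    · obtain ⟨d, rfl, rfl⟩ := exists_of_comp_eq h h1
      have e₁ : (t.comp d).length = t.length + d.length := Quiver.Path.length_comp _ _
      have e₂ : (t.comp d).length + q.length = t.length + (d.length + q.length) := by omega
      rw [e₂, e₁, cut_ordinalSum_right, cut_ordinalSum_right]
      exact (β.segment d.length (d.length + q.length) _ ⟨d, q, r, rfl, rfl, rfl, rfl⟩).comp_right s
    · by_cases h2 : p.length + q.length ≤ t.length
      · rw [← Quiver.Path.comp_assoc] at h
        obtain ⟨d, rfl, rfl⟩ := exists_of_comp_eq h.symm (by simpa using h2)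
        rw [cut_ordinalSum_left _ _ _ _ _ (by omega), cut_ordinalSum_left _ _ _ _ _ h2]
        exact (α.segment _ _ _ ⟨p, q, d, by simp, rfl, rfl, rfl⟩).comp_left s'
      · obtain ⟨d, rfl, h'⟩ := exists_of_comp_eq h.symm (by omega)
        have hl : (p.comp d).length = p.length + d.length := Quiver.Path.length_comp _ _
        obtain ⟨d', rfl, rfl⟩ := exists_of_comp_eq h'.symm (by omega)
        have e : p.length + (d.comp d').length = (p.comp d).length + d'.length := by
          simp only [Quiver.Path.length_comp]; omega
        rw [e, cut_ordinalSum_left _ _ _ _ _ (by omega), cut_ordinalSum_right, composePath_comp]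
        have a := α.segment p.length (p.comp d).length (composePath d)
          ⟨p, d, .nil, by simp, rfl, hl.symm, rfl⟩
        have b := β.segment 0 d'.length (composePath d') ⟨.nil, d', r, by simp, rfl, by simp, rfl⟩
        rw [hend] at a
        rw [hzero] at b
        exact a.glue b

lemma eqToHom_map' {A B : C} {s t : Quiver.Path A B} (h : s = t) (i) :
    Cell.map (eqToHom h) i = Fin.cast (congrArg _ h) i :=
  Fin.ext (eqToHom_map h i)

lemma hcomp_map {A B D : C} {s t : Quiver.Path A B} {s' t' : Quiver.Path B D} (α : s ⟶ t)
    (β : s' ⟶ t') (i) : (hcomp α β).map i =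
      ordinalSum α.map β.map (Quiver.Path.length_comp s s') (Quiver.Path.length_comp t t') i := rfl

end Paths

/-- The 2-path-category of a category `C`: the objects are those of `C`, the 1-cells `A ⟶ B` are
the paths of arrows of `C` from `A` to `B`, the 2-cells are those of `Cell`. -/
structure PathBicat (C : Type u) where
  as : C

section Bicat

variable {C : Type u} [Category.{v} C]

/-- Composition is concatenation, and the structural isomorphisms are identities. -/
instance : Bicategory (PathBicat C) where
  Hom A B := Quiver.Path A.as B.as
  id A := Quiver.Path.nil
  comp s t := s.comp t
  homCategory A B := pathCategory A.as B.as
  whiskerLeft s _ _ α := hcomp (𝟙 s) α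
  whiskerRight α s := hcomp α (𝟙 s)
  associator s t r := eqToIso (Quiver.Path.comp_assoc s t r)
  leftUnitor s := eqToIso (Quiver.Path.nil_comp s)
  rightUnitor s := eqToIso (Quiver.Path.comp_nil s)
  whiskerLeft_id := by
    intros; apply Cell.ext'; intro i
    simp [hcomp_map, ordinalSum]
    grind
  whiskerLeft_comp := by
    intros; apply Cell.ext'; intro i
    simp [hcomp_map, ordinalSum]
    grind
  id_whiskerLeft _ := by
    apply Cell.ext'; intro i
    simp [hcomp_map, eqToHom_map', ordinalSum]
    rfl
  comp_whiskerLeft := by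
    intros; apply Cell.ext'; intro i
    simp [hcomp_map, eqToHom_map', ordinalSum]
    grind
  id_whiskerRight := by
    intros; apply Cell.ext'; intro i
    simp [hcomp_map, ordinalSum]
    grind
  comp_whiskerRight := by
    intros; apply Cell.ext'; intro i
    simp [hcomp_map, ordinalSum]
    grind
  whiskerRight_id α := by
    apply Cell.ext'; intro i
    refine (ordinalSum_left α.map _ (Quiver.Path.length_comp _ _) (Quiver.Path.length_comp _ _)
      i i.2).trans ?_
    simp only [eqToHom_map', eqToIso.hom, eqToIso.inv, comp_map]
    rfl
  whiskerRight_comp := by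
    intros; apply Cell.ext'; intro i
    simp [hcomp_map, eqToHom_map', ordinalSum]
    grind
  whisker_assoc := by
    intros; apply Cell.ext'; intro i
    simp [hcomp_map, eqToHom_map', ordinalSum]
    grind
  whisker_exchange := by
    intros; apply Cell.ext'; intro i
    simp [hcomp_map, ordinalSum]
    grind
  pentagon := by
    intros; apply Cell.ext'; intro i
    simp [hcomp_map, eqToHom_map', ordinalSum]
    grind
  triangle s t := by
    apply Cell.ext'; intro i
    simp only [hcomp_map, eqToHom_map', ordinalSum, eqToIso.hom, comp_map, id_map, OrderHom.coe_mk]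
    have : (s.comp Quiver.Path.nil).length = s.length := rfl
    grind

end Bicat

namespace PathBicat

variable {C : Type u} [Category.{v} C]

/-- The arrow `f`, seen as a path of length one. -/
def edge {A B : C} (f : A ⟶ B) : (⟨A⟩ : PathBicat C) ⟶ ⟨B⟩ := f.toPath

/-- The length of a path. -/
def len {A B : PathBicat C} (s : A ⟶ B) : ℕ := Quiver.Path.length s

/-- The nondecreasing map underlying a 2-cell. -/
def lenMap {A B : PathBicat C} {s t : A ⟶ B} (α : s ⟶ t) : Fin (len s) →o Fin (len t) :=
  Cell.map α

lemma len_comp {A B D : PathBicat C} (s : A ⟶ B) (t : B ⟶ D) : len (s ≫ t) = len s + len t :=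
  Quiver.Path.length_comp s t

/-- The 2-cell `[0, A] ⟶ [1, 𝟙 A]` given by the map `0 → 1`. -/
def unitCell (A : C) : 𝟙 (⟨A⟩ : PathBicat C) ⟶ edge (𝟙 A) :=
  Cell.mk (s := Quiver.Path.nil) (t := (𝟙 A : A ⟶ A).toPath)
    ⟨fun i => i.elim0, fun i => i.elim0⟩
    (segment_toPath _ ⟨.nil, .nil, .nil, rfl, rfl, rfl, rfl⟩ ⟨.nil, .nil, .nil, rfl, rfl, rfl, rfl⟩
      ⟨.nil, .nil, .nil, rfl, rfl, rfl, rfl⟩)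

/-- The 2-cell `[2, A ⟶ B ⟶ D] ⟶ [1, A ⟶ D]` given by the map `2 → 1`, where the last arrow is the
composite of the first two. -/
def compCell {A B D : C} {f : A ⟶ B} {g : B ⟶ D} {h : A ⟶ D} (w : f ≫ g = h) :
    edge f ≫ edge g ⟶ edge h :=
  Cell.mk (s := f.toPath.comp g.toPath) (t := h.toPath)
    ⟨fun _ => (0 : Fin 1), fun _ _ _ => le_rfl⟩
    (segment_toPath _ ⟨.nil, .nil, f.toPath.comp g.toPath, rfl, rfl, rfl, rfl⟩
      ⟨.nil, f.toPath.comp g.toPath, .nil, rfl, rfl, rfl, by simpa using w⟩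
      ⟨f.toPath.comp g.toPath, .nil, .nil, rfl, rfl, rfl, rfl⟩)

/-- The map `[m] → [n]` of `SimplexCategory` dual to the nondecreasing map `n → m` underlying a
2-cell `[n, s] ⟶ [m, t]`: it sends the `j`-th vertex of `t` to the corresponding vertex of `s`. -/
def vertexMap {A B : PathBicat C} {s t : A ⟶ B} (α : s ⟶ t) : SimplexCategory.mk (len t) ⟶ SimplexCategory.mk (len s) :=
  SimplexCategory.mkHom
    ⟨fun j => ⟨cut (lenMap α) j, Nat.lt_succ_of_le (cut_le _ _)⟩, fun _ _ h => cut_mono _ h⟩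

/-- The inclusion of the vertices of `s` as the initial segment of those of `s ≫ t`. -/
def initialSegment {A B D : PathBicat C} (s : A ⟶ B) (t : B ⟶ D) : SimplexCategory.mk (len s) ⟶ SimplexCategory.mk (len (s ≫ t)) :=
  SimplexCategory.mkHom
    ⟨fun j => ⟨j, by have := j.2; rw [len_comp]; omega⟩, fun _ _ h => h⟩

/-- The inclusion of the vertices of `t` as the final segment of those of `s ≫ t`. -/
def finalSegment {A B D : PathBicat C} (s : A ⟶ B) (t : B ⟶ D) : SimplexCategory.mk (len t) ⟶ SimplexCategory.mk (len (s ≫ t)) :=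
  SimplexCategory.mkHom
    ⟨fun j => ⟨len s + j, by have := j.2; rw [len_comp]; omega⟩,
      fun _ _ h => Nat.add_le_add_left h _⟩

/-- The ordinal `n` as an object of the category of all finite ordinals (in which `.mk n` is the
ordinal `n + 1`, and the empty ordinal is the added initial object). -/
def ordinal : ℕ → AugmentedSimplexCategory
  | 0 => .star
  | n + 1 => .of (SimplexCategory.mk n)

/-- A nondecreasing map as a morphism of the category of all finite ordinals. -/
def ordinalMap : ∀ {n m : ℕ}, (Fin n →o Fin m) → (ordinal n ⟶ ordinal m)
  | 0, m, _ => WithInitial.starInitial.to (ordinal m)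
  | _ + 1, 0, u => (u 0).elim0
  | _ + 1, _ + 1, u => AugmentedSimplexCategory.inclusion.map (SimplexCategory.mkHom u)

/-- The length functor from paths to finite ordinals. -/
def length (A B : PathBicat C) : (A ⟶ B) ⥤ AugmentedSimplexCategory where
  obj s := ordinal (len s)
  map α := ordinalMap (lenMap α)
  map_id s := by
    suffices h : ∀ n, ordinalMap (OrderHom.id : Fin n →o Fin n) = 𝟙 _ from h _
    rintro (_ | n)
    · exact WithInitial.starInitial.hom_ext _ _
    · exact AugmentedSimplexCategory.inclusion.map_id _
  map_comp {s t r} α β := by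
    suffices h : ∀ {n m k : ℕ} (u : Fin n →o Fin m) (u' : Fin m →o Fin k),
        ordinalMap (u'.comp u) = ordinalMap u ≫ ordinalMap u' from h (lenMap α) (lenMap β)
    rintro (_ | n) (_ | m) (_ | k) u u'
    · exact WithInitial.starInitial.hom_ext _ _
    · exact WithInitial.starInitial.hom_ext _ _
    · exact WithInitial.starInitial.hom_ext _ _
    · exact WithInitial.starInitial.hom_ext _ _
    · exact (u 0).elim0
    · exact (u 0).elim0
    · exact (u' 0).elim0
    · exact AugmentedSimplexCategory.inclusion.map_comp (SimplexCategory.mkHom u)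
        (SimplexCategory.mkHom u')

lemma length_id (A : PathBicat C) : (length A A).obj (𝟙 A) = 𝟙_ AugmentedSimplexCategory := rfl

lemma length_comp {A B D : PathBicat C} (s : A ⟶ B) (t : B ⟶ D) :
    (length A D).obj (s ≫ t) = (length A B).obj s ⊗ (length B D).obj t := by
  suffices h : ∀ n m : ℕ, ordinal (n + m) = ordinal n ⊗ ordinal m from
    (congrArg ordinal (len_comp s t)).trans (h _ _)
  rintro (_ | n) (_ | m)
  · rfl
  · rw [Nat.zero_add]; rfl
  · rfl
  · have : n + 1 + (m + 1) = n + m + 1 + 1 := by omega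
    rw [this]; rfl

end PathBicat

/-! ### Bases of enrichment and path-objects -/

/-- A base of enrichment: a bicategory with a class of 2-cells that contains the invertible ones,
has the vertical `3 out of 2` property and is stable under horizontal composition. -/
structure Base (B : Type u) [Bicategory.{w, v} B] where
  W : ∀ X Y : B, MorphismProperty (X ⟶ Y)
  of_isIso : ∀ {X Y : B} {f g : X ⟶ Y} (α : f ⟶ g), IsIso α → W X Y α
  twoOutOfThree : ∀ {X Y : B}, (W X Y).HasTwoOutOfThreeProperty
  hcomp : ∀ {X Y Z : B} {f f' : X ⟶ Y} {g g' : Y ⟶ Z} (α : f ⟶ f') (β : g ⟶ g'),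
    W X Y α → W Y Z β → W X Z (Bicategory.whiskerRight α g ≫ Bicategory.whiskerLeft f' β)

/-- The smallest base on `B`: all invertible 2-cells. -/
def Base.iso (B : Type u) [Bicategory.{w, v} B] : Base B where
  W _ _ := MorphismProperty.isomorphisms _
  of_isIso _ h := h
  twoOutOfThree := inferInstance
  hcomp α β hα hβ := by
    rw [MorphismProperty.isomorphisms.iff] at *
    infer_instance

/-- The largest base on `B`: all 2-cells. -/
def Base.all (B : Type u) [Bicategory.{w, v} B] : Base B where
  W _ _ := ⊤
  of_isIso _ _ := trivial
  twoOutOfThree := inferInstance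
  hcomp _ _ _ _ := trivial

/-- A `C`-point of the base `(B, W)`: a colax morphism of bicategories from the 2-path-category of
`C` to `B` whose colaxity 2-cells are in `W`. -/
structure Point (C : Type u₁) [Category.{v₁} C] {B : Type u} [Bicategory.{w, v} B]
    (E : Base B) where
  F : OplaxFunctor (PathBicat C) B
  mapComp_mem : ∀ {X Y Z : PathBicat C} (s : X ⟶ Y) (t : Y ⟶ Z), E.W _ _ (F.mapComp s t)
  mapId_mem : ∀ X : PathBicat C, E.W _ _ (F.mapId X)

section Monoidal

variable {M : Type u} [Category.{v} M] [MonoidalCategory M]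

/-- The class of morphisms of `M` underlying a base on the associated bicategory. -/
def Base.mor (E : Base (MonoidalSingleObj M)) : MorphismProperty M :=
  E.W (.star M) (.star M)

namespace Point

variable {C : Type u₁} [Category.{v₁} C] {E : Base (MonoidalSingleObj M)}

/-- The value of a point on a path. -/
def obj (F : Point C E) {A B : PathBicat C} (s : A ⟶ B) : M := F.F.map s

/-- The value of a point on a 2-cell. -/
def map (F : Point C E) {A B : PathBicat C} {s t : A ⟶ B} (α : s ⟶ t) : F.obj s ⟶ F.obj t :=
  F.F.map₂ α

/-- The colaxity map for the composition. -/
def φ (F : Point C E) {A B D : PathBicat C} (s : A ⟶ B) (t : B ⟶ D) :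
    F.obj (s ≫ t) ⟶ F.obj s ⊗ F.obj t :=
  F.F.mapComp s t

/-- The colaxity map for the identity. -/
def φ₀ (F : Point C E) (A : PathBicat C) : F.obj (𝟙 A) ⟶ 𝟙_ M :=
  F.F.mapId A

/-- A morphism of points: a transformation of colax morphisms all of whose 1-cell components are
identities. -/
@[ext]
structure Hom (F G : Point C E) where
  app : ∀ {A B : PathBicat C} (s : A ⟶ B), F.obj s ⟶ G.obj s
  naturality : ∀ {A B : PathBicat C} {s t : A ⟶ B} (α : s ⟶ t),
    F.map α ≫ app t = app s ≫ G.map α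
  app_comp : ∀ {A B D : PathBicat C} (s : A ⟶ B) (t : B ⟶ D),
    F.φ s t ≫ (app s ⊗ₘ app t) = app (s ≫ t) ≫ G.φ s t
  app_id : ∀ A : PathBicat C, F.φ₀ A = app (𝟙 A) ≫ G.φ₀ A

instance : Category (Point C E) where
  Hom F G := Hom F G
  id F :=
    { app := fun _ => 𝟙 _
      naturality := by simp
      app_comp := by simp
      app_id := by simp }
  comp σ τ :=
    { app := fun s => σ.app s ≫ τ.app s
      naturality := fun α => by
        rw [← Category.assoc, σ.naturality, Category.assoc, τ.naturality, Category.assoc]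
      app_comp := fun s t => by
        rw [← MonoidalCategory.tensorHom_comp_tensorHom, ← Category.assoc, σ.app_comp,
          Category.assoc, τ.app_comp, Category.assoc]
      app_id := fun A => by rw [Category.assoc, ← τ.app_id, ← σ.app_id] }
  id_comp _ := Hom.ext (by funext; exact Category.id_comp _)
  comp_id _ := Hom.ext (by funext; exact Category.comp_id _)
  assoc _ _ _ := Hom.ext (by funext; exact Category.assoc _ _ _)

end Point

/-- The unit category `𝟏`. -/
abbrev One := Discrete PUnit.{1}

/-- The unique object of the 2-path-category of `𝟏`. -/
abbrev pt : PathBicat One := ⟨⟨⟨⟩⟩⟩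

/-- The path `[1, 𝟙]` in `𝟏`. -/
abbrev one : pt ⟶ pt := PathBicat.edge (𝟙 (⟨⟨⟩⟩ : One))

/-- The 2-cell `[0] ⟶ [1]`. -/
abbrev zeroToOne : 𝟙 pt ⟶ one := PathBicat.unitCell (⟨⟨⟩⟩ : One)

/-- The 2-cell `[2] ⟶ [1]`. -/
abbrev twoToOne : one ≫ one ⟶ one := PathBicat.compCell (Category.id_comp (𝟙 (⟨⟨⟩⟩ : One)))

open Functor.OplaxMonoidal in
/-- A homotopy monoid in the sense of Leinster in `M` with class of homotopy equivalences `W`: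
a colax monoidal functor from the category of all finite ordinals (including the empty one), with
the ordinal sum, to `M`, whose colaxity maps are in `W`. -/
structure HomotopyMonoid (E : Base (MonoidalSingleObj M)) where
  Y : AugmentedSimplexCategory ⥤ M
  [colax : Y.OplaxMonoidal]
  δ_mem : ∀ m n : AugmentedSimplexCategory, E.mor (δ Y m n)
  η_mem : E.mor (η Y)

namespace HomotopyMonoid

open Functor.OplaxMonoidal

attribute [instance] HomotopyMonoid.colax

variable {E : Base (MonoidalSingleObj M)}

/-- A morphism of homotopy monoids: a monoidal natural transformation. -/
@[ext]
structure Hom (Y Z : HomotopyMonoid E) where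
  τ : Y.Y ⟶ Z.Y
  δ_comp : ∀ m n : AugmentedSimplexCategory,
    δ Y.Y m n ≫ (τ.app m ⊗ₘ τ.app n) = τ.app (m ⊗ n) ≫ δ Z.Y m n
  η_comp : η Y.Y = τ.app (𝟙_ _) ≫ η Z.Y

instance : Category (HomotopyMonoid E) where
  Hom Y Z := Hom Y Z
  id Y :=
    { τ := 𝟙 Y.Y
      δ_comp := by simp
      η_comp := by simp }
  comp σ τ :=
    { τ := σ.τ ≫ τ.τ
      δ_comp := fun m n => by
        rw [NatTrans.comp_app, NatTrans.comp_app, NatTrans.comp_app,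
          ← MonoidalCategory.tensorHom_comp_tensorHom, ← Category.assoc, σ.δ_comp,
          Category.assoc, τ.δ_comp, Category.assoc]
      η_comp := by rw [NatTrans.comp_app, Category.assoc, ← τ.η_comp, ← σ.η_comp] }
  id_comp _ := Hom.ext (Category.id_comp _)
  comp_id _ := Hom.ext (Category.comp_id _)
  assoc _ _ _ := Hom.ext (Category.assoc _ _ _)

end HomotopyMonoid

end Monoidal

end SegalPath

/-!
A nondecreasing map `u : n → m` is determined by its cuts, the numbers `cut u j` of elements sent
below `j`, and these form an arbitrary endpoint-preserving nondecreasing map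
`{0, …, m} → {0, …, n}` (`exists_cut_eq`). In the unit category `𝟏` a path is its length and a
2-cell is any nondecreasing map, so every identity between 2-cells is checked on cuts.

*Homotopy monoids.* The length functor from paths in `𝟏` to finite ordinals is a monoidal
equivalence (`lengthCore`), and a `𝟏`-point is the same as a colax monoidal functor on paths.
Composition with the length functor is therefore an equivalence from homotopy monoids to points
(`HomotopyMonoid.toPoint`).

*Simplicial objects.* A simplicial object `X` gives the point with values `X (len s)`, on which
the 2-cells act through their cuts, and whose colaxity maps restrict to the initial and the final
segment (`Simplicial.toPoint`). Conversely, every map of simplices factors uniquely as an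
endpoint-preserving map followed by the inclusion of an interval (`Simplicial.Factorization`). In
a point, the first factor acts through the corresponding 2-cell and the second one through the
components of the colaxity maps. Functoriality (`Simplicial.Factorization.map_comp_map`) holds
because an interval can be pulled back along a 2-cell, by naturality and associativity of the
colaxity maps.

In both cases the equivalence sought is inverse to a strictly defined functor to points. The
isomorphisms `θ` are the components of the inverse of its unit, which are morphisms of points, and
the required identities are the laws of these morphisms.

*Monoids.* If the colaxity maps are isomorphisms, the value at the path of length one is a monoid
(`StrongPoint.toMon`). This functor is full and faithful because a morphism is determined by its
component at the path of length one, and because the 2-cells `0 → 1` and `2 → 1` generate all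
others under composition and concatenation (`cell_induction`). It is essentially surjective
because a monoid `A` gives the point of its tensor powers, where a 2-cell acts by multiplying the
factors between consecutive cuts (`MonoidPower.toPoint`); functoriality is
`MonoidPower.cutMap_comp`, which rests on the general associativity law
`MonoidPower.split_powMul`.
-/

namespace SegalPath

/-! ### Cut functions -/

lemma cut_zero {n m : ℕ} (u : Fin n →o Fin m) : cut u 0 = 0 :=
  cut_eq _ _ _ (Nat.zero_le _) fun i => by simp

lemma cut_of_le {n m : ℕ} (u : Fin n →o Fin m) {j : ℕ} (h : m ≤ j) : cut u j = n :=
  cut_eq _ _ _ le_rfl fun i => ⟨fun _ => (u i).2.trans_le h, fun _ => i.2⟩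

lemma cut_id {n : ℕ} {j : ℕ} (h : j ≤ n) : cut (OrderHom.id : Fin n →o Fin n) j = j :=
  cut_eq _ _ _ h fun _ => Iff.rfl

/-- Cuts are contravariant: they are the maps dual to nondecreasing maps of ordinals. -/
lemma cut_comp {n m k : ℕ} (u : Fin n →o Fin m) (v : Fin m →o Fin k) (j : ℕ) :
    cut (v.comp u) j = cut u (cut v j) :=
  cut_eq _ _ _ (cut_le _ _) fun i => by rw [lt_cut_iff, lt_cut_iff]; rfl

/-- A nondecreasing map of ordinals is determined by its cuts. -/
lemma eq_of_cut_eq {n m : ℕ} {u v : Fin n →o Fin m} (h : ∀ j ≤ m, cut u j = cut v j) : u = v := by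
  refine OrderHom.ext _ _ (funext fun i => Fin.ext ?_)
  -- `u i < j` and `v i < j` are equivalent for all `j ≤ m`; take `j = u i + 1` and `j = v i + 1`
  have key : ∀ j ≤ m, (u i : ℕ) < j ↔ (v i : ℕ) < j := fun j hj => by
    rw [← lt_cut_iff, ← lt_cut_iff, h j hj]
  have h1 := key (u i + 1) (u i).2
  have h2 := key (v i + 1) (v i).2
  omega

/-- Every nondecreasing function `{0, …, m} → {0, …, n}` that preserves both endpoints is the cut
function of a nondecreasing map `n → m`. -/
lemma exists_cut_eq {n m : ℕ} (c : ℕ → ℕ) (hc : ∀ i j, i ≤ j → j ≤ m → c i ≤ c j) (h0 : c 0 = 0)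
    (hm : c m = n) : ∃ u : Fin n →o Fin m, ∀ j ≤ m, cut u j = c j := by
  classical
  -- the map sends `i` to the least `j` with `i < c (j + 1)`
  have ex : ∀ i : Fin n, ∃ j, (i : ℕ) < c (j + 1) := fun i => by
    refine ⟨m - 1, ?_⟩
    have := i.2
    have hm0 : m ≠ 0 := by rintro rfl; omega
    rw [Nat.sub_add_cancel (by omega)]
    omega
  have spec : ∀ i : Fin n, (i : ℕ) < c (Nat.find (ex i) + 1) := fun i => Nat.find_spec (ex i)
  have hlt : ∀ (i : Fin n) (j : ℕ), j ≤ m → ((i : ℕ) < c j ↔ Nat.find (ex i) < j) := by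
    intro i j hj
    constructor
    · intro h
      rcases j with _ | j
      · omega
      · exact Nat.lt_succ_of_le (Nat.find_min' (ex i) h)
    · intro h
      exact (spec i).trans_le (hc _ _ h hj)
  have hn : ∀ i : Fin n, Nat.find (ex i) < m := fun i => (hlt i m le_rfl).1 (by rw [hm]; exact i.2)
  refine ⟨⟨fun i => ⟨Nat.find (ex i), hn i⟩, fun i i' h => ?_⟩, fun j hj => ?_⟩
  · exact Nat.find_min' (ex i) (lt_of_le_of_lt (show (i : ℕ) ≤ i' from h) (spec i'))
  · exact cut_eq _ _ _ (hm ▸ hc _ _ hj le_rfl) fun i => hlt i j hj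

/-! ### Colaxity in monoidal terms -/

section Monoidal

variable {M : Type u} [Category.{v} M] [MonoidalCategory M]

namespace Base

variable (E : Base (MonoidalSingleObj M))

lemma mor_of_isIso {X Y : M} (f : X ⟶ Y) [h : IsIso f] : E.mor f := E.of_isIso _ h

lemma mor_comp {X Y Z : M} {f : X ⟶ Y} {g : Y ⟶ Z} (hf : E.mor f) (hg : E.mor g) :
    E.mor (f ≫ g) :=
  haveI := E.twoOutOfThree (X := .star M) (Y := .star M)
  (E.W (.star M) (.star M)).comp_mem _ _ hf hg

end Base

namespace Point

variable {C : Type u₁} [Category.{v₁} C] {E : Base (MonoidalSingleObj M)}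

section laws

variable (F : Point C E) {A B D K : PathBicat C}

@[simp] lemma map_id (s : A ⟶ B) : F.map (𝟙 s) = 𝟙 (F.obj s) := F.F.map₂_id s

lemma map_comp {s t r : A ⟶ B} (α : s ⟶ t) (β : t ⟶ r) :
    F.map (α ≫ β) = F.map α ≫ F.map β := F.F.map₂_comp α β

instance isIso_map {s t : A ⟶ B} (α : s ⟶ t) [IsIso α] : IsIso (F.map α) :=
  ⟨F.map (inv α), by rw [← F.map_comp, IsIso.hom_inv_id, map_id],
    by rw [← F.map_comp, IsIso.inv_hom_id, map_id]⟩

lemma map_whiskerRight_φ {s s' : A ⟶ B} (α : s ⟶ s') (t : B ⟶ D) :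
    F.map (Bicategory.whiskerRight α t) ≫ F.φ s' t = F.φ s t ≫ F.map α ▷ F.obj t :=
  F.F.mapComp_naturality_left α t

lemma map_whiskerLeft_φ (s : A ⟶ B) {t t' : B ⟶ D} (α : t ⟶ t') :
    F.map (Bicategory.whiskerLeft s α) ≫ F.φ s t' = F.φ s t ≫ F.obj s ◁ F.map α :=
  F.F.mapComp_naturality_right s α

lemma map_hcomp_φ {s s' : A ⟶ B} {t t' : B ⟶ D} (α : s ⟶ s') (β : t ⟶ t') :
    F.map (Bicategory.whiskerRight α t ≫ Bicategory.whiskerLeft s' β) ≫ F.φ s' t' =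
      F.φ s t ≫ (F.map α ⊗ₘ F.map β) := by
  rw [map_comp, Category.assoc, map_whiskerLeft_φ, ← Category.assoc, map_whiskerRight_φ,
    Category.assoc, MonoidalCategory.tensorHom_def]

lemma map_associator_φ (s : A ⟶ B) (t : B ⟶ D) (r : D ⟶ K) :
    F.map (Bicategory.associator s t r).hom ≫ F.φ s (t ≫ r) ≫ F.obj s ◁ F.φ t r =
      F.φ (s ≫ t) r ≫ F.φ s t ▷ F.obj r ≫ (α_ (F.obj s) (F.obj t) (F.obj r)).hom :=
  F.F.map₂_associator s t r

lemma map_leftUnitor (s : A ⟶ B) : F.map (Bicategory.leftUnitor s).hom =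
    F.φ (𝟙 A) s ≫ F.φ₀ A ▷ F.obj s ≫ (λ_ (F.obj s)).hom :=
  F.F.map₂_leftUnitor s

lemma map_rightUnitor (s : A ⟶ B) : F.map (Bicategory.rightUnitor s).hom =
    F.φ s (𝟙 B) ≫ F.obj s ◁ F.φ₀ B ≫ (ρ_ (F.obj s)).hom :=
  F.F.map₂_rightUnitor s

lemma φ_mem (s : A ⟶ B) (t : B ⟶ D) : E.mor (F.φ s t) := F.mapComp_mem s t

lemma φ₀_mem (A : PathBicat C) : E.mor (F.φ₀ A) := F.mapId_mem A

end laws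

@[simp] lemma id_app (F : Point C E) {A B : PathBicat C} (s : A ⟶ B) :
    Hom.app (𝟙 F) s = 𝟙 (F.obj s) := rfl

@[simp] lemma comp_app {F G H : Point C E} (σ : F ⟶ G) (τ : G ⟶ H) {A B : PathBicat C}
    (s : A ⟶ B) : Hom.app (σ ≫ τ) s = σ.app s ≫ τ.app s := rfl

/-- A componentwise isomorphism of points, from components that satisfy the laws of a morphism. -/
def isoMk {F G : Point C E} (e : ∀ {A B : PathBicat C} (s : A ⟶ B), F.obj s ≅ G.obj s)
    (naturality : ∀ {A B : PathBicat C} {s t : A ⟶ B} (α : s ⟶ t),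
      F.map α ≫ (e t).hom = (e s).hom ≫ G.map α)
    (app_comp : ∀ {A B D : PathBicat C} (s : A ⟶ B) (t : B ⟶ D),
      F.φ s t ≫ ((e s).hom ⊗ₘ (e t).hom) = (e (s ≫ t)).hom ≫ G.φ s t)
    (app_id : ∀ A : PathBicat C, F.φ₀ A = (e (𝟙 A)).hom ≫ G.φ₀ A) : F ≅ G where
  hom := ⟨fun s => (e s).hom, naturality, app_comp, app_id⟩
  inv :=
    ⟨fun s => (e s).inv, fun α => by rw [Iso.comp_inv_eq, Category.assoc, naturality,
        Iso.inv_hom_id_assoc],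
      fun s t => by
        rw [Iso.eq_inv_comp, ← Category.assoc, ← app_comp, Category.assoc,
          MonoidalCategory.tensorHom_comp_tensorHom, Iso.hom_inv_id, Iso.hom_inv_id,
          MonoidalCategory.id_tensorHom_id, Category.comp_id],
      fun A => by rw [app_id, Iso.inv_hom_id_assoc]⟩
  hom_inv_id := Hom.ext (by funext A B s; exact (e s).hom_inv_id)
  inv_hom_id := Hom.ext (by funext A B s; exact (e s).inv_hom_id)

/-- The component of an isomorphism of points at a path. -/
def appIso {F G : Point C E} (σ : F ≅ G) {A B : PathBicat C} (s : A ⟶ B) : F.obj s ≅ G.obj s where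
  hom := σ.hom.app s
  inv := σ.inv.app s
  hom_inv_id := by rw [← comp_app, σ.hom_inv_id, id_app]
  inv_hom_id := by rw [← comp_app, σ.inv_hom_id, id_app]

/-- A point with values in a monoidal category, from its colaxity data in monoidal terms. -/
def mk' (obj : ∀ {A B : PathBicat C}, (A ⟶ B) → M)
    (map : ∀ {A B : PathBicat C} {s t : A ⟶ B}, (s ⟶ t) → (obj s ⟶ obj t))
    (φ : ∀ {A B D : PathBicat C} (s : A ⟶ B) (t : B ⟶ D), obj (s ≫ t) ⟶ obj s ⊗ obj t)
    (φ₀ : ∀ A : PathBicat C, obj (𝟙 A) ⟶ 𝟙_ M)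
    (map_id : ∀ {A B : PathBicat C} (s : A ⟶ B), map (𝟙 s) = 𝟙 (obj s))
    (map_comp : ∀ {A B : PathBicat C} {s t r : A ⟶ B} (α : s ⟶ t) (β : t ⟶ r),
      map (α ≫ β) = map α ≫ map β)
    (nat_left : ∀ {A B D : PathBicat C} {s s' : A ⟶ B} (α : s ⟶ s') (t : B ⟶ D),
      map (Bicategory.whiskerRight α t) ≫ φ s' t = φ s t ≫ map α ▷ obj t)
    (nat_right : ∀ {A B D : PathBicat C} (s : A ⟶ B) {t t' : B ⟶ D} (α : t ⟶ t'),
      map (Bicategory.whiskerLeft s α) ≫ φ s t' = φ s t ≫ obj s ◁ map α)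
    (assoc : ∀ {A B D K : PathBicat C} (s : A ⟶ B) (t : B ⟶ D) (r : D ⟶ K),
      map (Bicategory.associator s t r).hom ≫ φ s (t ≫ r) ≫ obj s ◁ φ t r =
        φ (s ≫ t) r ≫ φ s t ▷ obj r ≫ (α_ (obj s) (obj t) (obj r)).hom)
    (left_unit : ∀ {A B : PathBicat C} (s : A ⟶ B),
      map (Bicategory.leftUnitor s).hom = φ (𝟙 A) s ≫ φ₀ A ▷ obj s ≫ (λ_ (obj s)).hom)
    (right_unit : ∀ {A B : PathBicat C} (s : A ⟶ B),
      map (Bicategory.rightUnitor s).hom = φ s (𝟙 B) ≫ obj s ◁ φ₀ B ≫ (ρ_ (obj s)).hom)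
    (φ_mem : ∀ {A B D : PathBicat C} (s : A ⟶ B) (t : B ⟶ D), E.mor (φ s t))
    (φ₀_mem : ∀ A : PathBicat C, E.mor (φ₀ A)) : Point C E where
  F :=
    { obj := fun _ => .star M
      map := fun s => obj s
      map₂ := fun α => map α
      map₂_id := map_id
      map₂_comp := map_comp
      mapId := φ₀
      mapComp := φ
      mapComp_naturality_left := nat_left
      mapComp_naturality_right := nat_right
      map₂_associator := assoc
      map₂_leftUnitor := left_unit
      map₂_rightUnitor := right_unit }
  mapComp_mem := φ_mem
  mapId_mem := φ₀_mem

end Point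

end Monoidal

/-! ### Paths in the unit category -/

section One

/-- The path of length `n` in `𝟏`. -/
def path : ℕ → (pt ⟶ pt)
  | 0 => Quiver.Path.nil
  | n + 1 => Quiver.Path.cons (path n) (𝟙 _)

@[simp] lemma len_path (n : ℕ) : PathBicat.len (path n) = n := by
  induction n with
  | zero => rfl
  | succ n ih => exact congrArg (· + 1) ih

/-- A path in `𝟏` is determined by its length. -/
lemma path_ext {A B : PathBicat One} {s t : A ⟶ B} (h : PathBicat.len s = PathBicat.len t) :
    s = t := by
  obtain ⟨A⟩ := A
  obtain ⟨B⟩ := B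
  change Quiver.Path A B at s t
  change s.length = t.length at h
  induction s with
  | nil =>
    exact (Quiver.Path.eq_nil_of_length_zero t (by simpa using h.symm)).symm
  | cons s e ih =>
    cases t with
    | nil => simp at h
    | cons t e' =>
      rename_i X _ Y
      obtain rfl : X = Y := Subsingleton.elim _ _
      obtain rfl : e = e' := Subsingleton.elim _ _
      rw [ih (t := t) (by simpa using h)]

lemma path_len (s : pt ⟶ pt) : path (PathBicat.len s) = s := path_ext (len_path _)

/-- A path in `𝟏` can be split at any of its vertices. -/
lemma exists_split (s : pt ⟶ pt) (i : ℕ) (h : i ≤ PathBicat.len s) :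
    ∃ p q : pt ⟶ pt, s = p ≫ q ∧ PathBicat.len p = i :=
  ⟨path i, path (PathBicat.len s - i), path_ext (by
    rw [PathBicat.len_comp, len_path, len_path]; omega), len_path i⟩

/-- In `𝟏` every arrow is the composite of every segment, so all nondecreasing maps are 2-cells. -/
lemma hasSegment_one {A B X Y : One} (s : Quiver.Path A B) {i j : ℕ} (f : X ⟶ Y) (hij : i ≤ j)
    (hj : j ≤ s.length) : HasSegment s i j f := by
  obtain ⟨p, r, hs, hp⟩ := exists_split s j hj
  obtain ⟨p, q, rfl, hp'⟩ := exists_split p i (hp ▸ hij)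
  exact ⟨p, q, r, hs.trans (Quiver.Path.comp_assoc _ _ _), hp',
    (Quiver.Path.length_comp p q).symm.trans hp, Subsingleton.elim _ _⟩

/-- The 2-cell between paths in `𝟏` given by a nondecreasing map. -/
def cellMk {A B : PathBicat One} {s t : A ⟶ B}
    (u : Fin (PathBicat.len s) →o Fin (PathBicat.len t)) : s ⟶ t :=
  Cell.mk (s := s) (t := t) u fun _ _ _ _ f h =>
    hasSegment_one (X := _) (Y := _) (A := A.as) (B := B.as) s f (cut_mono u h.le.1) (cut_le _ _)

@[simp] lemma lenMap_cellMk {A B : PathBicat One} {s t : A ⟶ B}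
    (u : Fin (PathBicat.len s) →o Fin (PathBicat.len t)) : PathBicat.lenMap (cellMk u) = u := rfl

lemma cell_ext {C : Type u₁} [Category.{v₁} C] {A B : PathBicat C} {s t : A ⟶ B} {α β : s ⟶ t}
    (h : PathBicat.lenMap α = PathBicat.lenMap β) : α = β :=
  Cell.ext h

lemma cell_ext_cut {C : Type u₁} [Category.{v₁} C] {A B : PathBicat C} {s t : A ⟶ B} {α β : s ⟶ t}
    (h : ∀ j ≤ PathBicat.len t, cut (PathBicat.lenMap α) j = cut (PathBicat.lenMap β) j) : α = β :=
  cell_ext (eq_of_cut_eq h)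

/-- There is at most one 2-cell to a path of length one. -/
instance {s : pt ⟶ pt} : Subsingleton (s ⟶ one) :=
  ⟨fun _ _ => cell_ext (OrderHom.ext _ _ (funext fun _ => Subsingleton.elim (α := Fin 1) _ _))⟩

section

variable {C : Type u₁} [Category.{v₁} C] {A B D : PathBicat C}

lemma cut_lenMap_comp {s t r : A ⟶ B} (α : s ⟶ t) (β : t ⟶ r) (j : ℕ) :
    cut (PathBicat.lenMap (α ≫ β)) j = cut (PathBicat.lenMap α) (cut (PathBicat.lenMap β) j) :=
  cut_comp _ _ j

lemma cut_lenMap_id (s : A ⟶ B) {j : ℕ} (hj : j ≤ PathBicat.len s) :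
    cut (PathBicat.lenMap (𝟙 s)) j = j :=
  cut_id hj

lemma cut_lenMap_eqToHom {s t : A ⟶ B} (h : s = t) {j : ℕ} (hj : j ≤ PathBicat.len t) :
    cut (PathBicat.lenMap (eqToHom h)) j = j := by
  subst h; exact cut_id hj

lemma cut_lenMap_hcomp_left {s t : A ⟶ B} {s' t' : B ⟶ D} (α : s ⟶ t) (β : s' ⟶ t') {j : ℕ}
    (hj : j ≤ PathBicat.len t) :
    cut (PathBicat.lenMap (s := s ≫ s') (t := t ≫ t') (hcomp α β)) j = cut (PathBicat.lenMap α) j :=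
  cut_ordinalSum_left _ _ (PathBicat.len_comp s s') (PathBicat.len_comp t t') j hj

lemma cut_lenMap_hcomp_right {s t : A ⟶ B} {s' t' : B ⟶ D} (α : s ⟶ t) (β : s' ⟶ t') (j : ℕ) :
    cut (PathBicat.lenMap (s := s ≫ s') (t := t ≫ t') (hcomp α β)) (PathBicat.len t + j) =
      PathBicat.len s + cut (PathBicat.lenMap β) j :=
  cut_ordinalSum_right _ _ (PathBicat.len_comp s s') (PathBicat.len_comp t t') j

/-- Both whiskerings together are the concatenation of 2-cells. -/
lemma whiskerRight_comp_whiskerLeft {s t : A ⟶ B} {s' t' : B ⟶ D} (α : s ⟶ t) (β : s' ⟶ t') :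
    Bicategory.whiskerRight α s' ≫ Bicategory.whiskerLeft t β = hcomp α β := by
  refine cell_ext_cut fun j hj => ?_
  rw [cut_lenMap_comp]
  change cut (PathBicat.lenMap (s := s ≫ s') (t := t ≫ s') (hcomp α (𝟙 s')))
    (cut (PathBicat.lenMap (s := t ≫ s') (t := t ≫ t') (hcomp (𝟙 t) β)) j) = _
  rcases le_total j (PathBicat.len t) with h | h
  · rw [cut_lenMap_hcomp_left _ _ h, cut_lenMap_hcomp_left _ _ h, cut_lenMap_id _ h,
      cut_lenMap_hcomp_left _ _ h]
  · obtain ⟨j, rfl⟩ := Nat.exists_eq_add_of_le h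
    rw [PathBicat.len_comp] at hj
    rw [cut_lenMap_hcomp_right, cut_lenMap_hcomp_right, cut_lenMap_hcomp_right,
      cut_lenMap_id _ (cut_le _ _)]

end

/-- A 2-cell to a concatenation is the concatenation of two 2-cells, up to the equality between its
domain and the concatenation of theirs. -/
lemma exists_hcomp {s t t' : pt ⟶ pt} (α : s ⟶ t ≫ t') :
    ∃ (p p' : pt ⟶ pt) (h : s = p ≫ p') (β : p ⟶ t) (β' : p' ⟶ t'),
      α = eqToHom h ≫ Bicategory.whiskerRight β p' ≫ Bicategory.whiskerLeft t β' := by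
  -- the domain is split at the cut of `α` that corresponds to the end of `t`
  obtain ⟨p, p', h, hp⟩ := exists_split s (cut (PathBicat.lenMap α) (PathBicat.len t)) (cut_le _ _)
  have hle : PathBicat.len t ≤ PathBicat.len (t ≫ t') := by rw [PathBicat.len_comp]; omega
  subst h
  obtain ⟨u, hu⟩ := exists_cut_eq (n := PathBicat.len p) (m := PathBicat.len t)
    (cut (PathBicat.lenMap α)) (fun i j hij _ => cut_mono _ hij) (cut_zero _) hp.symm
  obtain ⟨u', hu'⟩ := exists_cut_eq (n := PathBicat.len p') (m := PathBicat.len t')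
    (fun j => cut (PathBicat.lenMap α) (PathBicat.len t + j) - PathBicat.len p)
    (fun i j hij _ => Nat.sub_le_sub_right (cut_mono _ (by omega)) _) (by simp [hp])
    (by
      rw [cut_of_le _ (by rw [PathBicat.len_comp]), PathBicat.len_comp]; omega)
  refine ⟨p, p', rfl, cellMk u, cellMk u', cell_ext_cut fun j hj => ?_⟩
  rw [whiskerRight_comp_whiskerLeft, eqToHom_refl, Category.id_comp]
  rcases le_total j (PathBicat.len t) with h | h
  · rw [cut_lenMap_hcomp_left _ _ h, lenMap_cellMk, hu j h]
  · obtain ⟨j, rfl⟩ := Nat.exists_eq_add_of_le h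
    rw [PathBicat.len_comp] at hj
    rw [cut_lenMap_hcomp_right, lenMap_cellMk, hu' j (by omega)]
    have := cut_mono (PathBicat.lenMap α) h
    omega

end One

/-! ### `𝟏`-points as colax monoidal functors -/

section

variable {M : Type u} [Category.{v} M] [MonoidalCategory M] {E : Base (MonoidalSingleObj M)}

namespace Point

open Functor.OplaxMonoidal

/-- The `𝟏`-point given by a colax monoidal functor on the monoidal category of paths in `𝟏`. -/
def ofOplax (H : (pt ⟶ pt) ⥤ M) [H.OplaxMonoidal] (hδ : ∀ s t, E.mor (δ H s t))
    (hη : E.mor (η H)) : Point One E :=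
  mk' (fun s => H.obj s) (fun α => H.map α) (fun s t => δ H s t) (fun _ => η H)
    (fun s => H.map_id s) (fun α β => H.map_comp α β)
    (fun α t => (δ_natural_left H α t).symm)
    (fun s _ _ α => (δ_natural_right H s α).symm)
    (fun s t r => (oplax_associativity H s t r).symm)
    (fun s => (left_unitality_hom H s).symm)
    (fun s => (right_unitality_hom H s).symm)
    (fun s t => hδ s t)
    (fun _ => hη)

/-- The functor on the monoidal category of paths in `𝟏` that underlies a point. -/
def functor (F : Point One E) : (pt ⟶ pt) ⥤ M where
  obj s := F.obj s
  map α := F.map α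
  map_id s := F.map_id s
  map_comp α β := F.map_comp α β

/-- The left unit law in the form that Mathlib's colax monoidal functors use. -/
lemma leftUnitor_inv (F : Point One E) (s : pt ⟶ pt) : (λ_ (F.obj s)).inv =
    F.map (Bicategory.leftUnitor s).inv ≫ F.φ (𝟙 pt) s ≫ F.φ₀ pt ▷ F.obj s := by
  have h := F.map_leftUnitor s
  rw [← cancel_mono (λ_ (F.obj s)).hom, Iso.inv_hom_id, Category.assoc, Category.assoc, ← h,
    ← F.map_comp, Iso.inv_hom_id, map_id]

/-- The right unit law in the form that Mathlib's colax monoidal functors use. -/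
lemma rightUnitor_inv (F : Point One E) (s : pt ⟶ pt) : (ρ_ (F.obj s)).inv =
    F.map (Bicategory.rightUnitor s).inv ≫ F.φ s (𝟙 pt) ≫ F.obj s ◁ F.φ₀ pt := by
  have h := F.map_rightUnitor s
  rw [← cancel_mono (ρ_ (F.obj s)).hom, Iso.inv_hom_id, Category.assoc, Category.assoc, ← h,
    ← F.map_comp, Iso.inv_hom_id, map_id]

instance (F : Point One E) : F.functor.OplaxMonoidal where
  η := F.φ₀ pt
  δ s t := F.φ s t
  δ_natural_left α t := (F.map_whiskerRight_φ α t).symm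
  δ_natural_right t α := (F.map_whiskerLeft_φ t α).symm
  oplax_associativity s t r := (F.map_associator_φ s t r).symm
  oplax_left_unitality s := F.leftUnitor_inv s
  oplax_right_unitality s := F.rightUnitor_inv s

/-- For the unit category, a morphism of points is given by its components at the endo-paths of
the unique object. -/
def homMk {F G : Point One E} (app : ∀ s : pt ⟶ pt, F.obj s ⟶ G.obj s)
    (naturality : ∀ {s t : pt ⟶ pt} (α : s ⟶ t), F.map α ≫ app t = app s ≫ G.map α)
    (app_comp : ∀ (s t : pt ⟶ pt), F.φ s t ≫ (app s ⊗ₘ app t) = app (s ≫ t) ≫ G.φ s t)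
    (app_id : F.φ₀ pt = app (𝟙 pt) ≫ G.φ₀ pt) : F ⟶ G :=
  Hom.mk (F := F) (G := G) (fun s => app s) (fun α => naturality α) (fun s t => app_comp s t)
    (fun _ => app_id)

lemma hom_ext {F G : Point One E} {σ τ : F ⟶ G} (h : ∀ s : pt ⟶ pt, σ.app s = τ.app s) : σ = τ :=
  Hom.ext (by funext A B s; exact h s)

/-- The isomorphism of `𝟏`-points given by its components at the endo-paths. -/
def isoMkOne {F G : Point One E} (e : ∀ s : pt ⟶ pt, F.obj s ≅ G.obj s)
    (naturality : ∀ {s t : pt ⟶ pt} (α : s ⟶ t), F.map α ≫ (e t).hom = (e s).hom ≫ G.map α)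
    (app_comp : ∀ (s t : pt ⟶ pt),
      F.φ s t ≫ ((e s).hom ⊗ₘ (e t).hom) = (e (s ≫ t)).hom ≫ G.φ s t)
    (app_id : F.φ₀ pt = (e (𝟙 pt)).hom ≫ G.φ₀ pt) : F ≅ G :=
  isoMk (F := F) (G := G) (fun s => e s) (fun α => naturality α) (fun s t => app_comp s t)
    (fun _ => app_id)

end Point

end

/-! ### The length functor as a monoidal equivalence -/

section Length

open PathBicat AugmentedSimplexCategory

/-- Nondecreasing maps are composed as morphisms of the category of ordinals. -/
lemma ordinalMap_comp {n m k : ℕ} (u : Fin n →o Fin m) (v : Fin m →o Fin k) :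
    ordinalMap (v.comp u) = ordinalMap u ≫ ordinalMap v := by
  obtain ⟨s, rfl⟩ : ∃ s : pt ⟶ pt, len s = n := ⟨path n, len_path n⟩
  obtain ⟨t, rfl⟩ : ∃ s : pt ⟶ pt, len s = m := ⟨path m, len_path m⟩
  obtain ⟨r, rfl⟩ : ∃ s : pt ⟶ pt, len s = k := ⟨path k, len_path k⟩
  exact (length pt pt).map_comp (cellMk u : s ⟶ t) (cellMk v : t ⟶ r)

lemma ordinalMap_eq_eqToHom {n m : ℕ} (h : n = m) (u : Fin n →o Fin m) (hu : ∀ i, (u i : ℕ) = i) :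
    ordinalMap u = eqToHom (congrArg ordinal h) := by
  subst h
  obtain rfl : u = OrderHom.id := OrderHom.ext _ _ (funext fun i => Fin.ext (hu i))
  rcases n with _ | n
  · exact WithInitial.starInitial.hom_ext _ _
  · exact AugmentedSimplexCategory.inclusion.map_id _

lemma ordinalMap_injective {n m : ℕ} : Function.Injective (ordinalMap : (Fin n →o Fin m) → _) := by
  intro u v h
  rcases n with _ | n
  · exact OrderHom.ext _ _ (funext fun i => i.elim0)
  rcases m with _ | m
  · exact (u 0).elim0
  · exact congrArg SimplexCategory.Hom.toOrderHom
      (AugmentedSimplexCategory.inclusion.map_injective h)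

lemma ordinalMap_surjective {n m : ℕ} :
    Function.Surjective (ordinalMap : (Fin n →o Fin m) → _) := by
  intro f
  rcases n with _ | n
  · exact ⟨⟨fun i => i.elim0, fun i => i.elim0⟩, WithInitial.starInitial.hom_ext _ _⟩
  rcases m with _ | m
  · exact (f : PEmpty).elim
  · obtain ⟨g, rfl⟩ := AugmentedSimplexCategory.inclusion.map_surjective f
    exact ⟨g.toOrderHom, rfl⟩

lemma exists_ordinal_eq (x : AugmentedSimplexCategory) : ∃ n, ordinal n = x := by
  rcases x with n | _
  · exact ⟨n.len + 1, rfl⟩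
  · exact ⟨0, rfl⟩

instance : (length pt pt).Full where
  map_surjective {s t} f := by
    obtain ⟨u, hu⟩ := ordinalMap_surjective f
    exact ⟨cellMk u, hu⟩

instance : (length pt pt).Faithful where
  map_injective h := cell_ext (ordinalMap_injective h)

instance : (length pt pt).EssSurj where
  mem_essImage x := by
    obtain ⟨n, rfl⟩ := exists_ordinal_eq x
    exact ⟨path n, ⟨eqToIso (congrArg ordinal (len_path n))⟩⟩

instance : (length pt pt).IsEquivalence where

lemma ordinal_add (n m : ℕ) : ordinal (n + m) = ordinal n ⊗ ordinal m := by
  have := length_comp (path n) (path m)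
  change ordinal (len (path n ≫ path m)) = ordinal (len (path n)) ⊗ ordinal (len (path m)) at this
  rwa [len_comp, len_path, len_path] at this

/-- The inclusion of the first summand of an ordinal sum, as a nondecreasing map. -/
lemma inl_ordinal (n m : ℕ) : inl (ordinal n) (ordinal m) =
    ordinalMap (Fin.castAddOrderEmb m).toOrderHom ≫ eqToHom (ordinal_add n m) := by
  rcases n with _ | n
  · exact WithInitial.starInitial.hom_ext _ _
  rcases m with _ | m
  · have : ordinalMap (Fin.castAddOrderEmb (n := n + 1) 0).toOrderHom = 𝟙 (ordinal (n + 1)) :=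
      AugmentedSimplexCategory.inclusion.map_id _
    rw [this, Category.id_comp]
    rfl
  · have h : SimplexCategory.mk (n + 1 + m) =
        tensorObjOf (SimplexCategory.mk n) (SimplexCategory.mk m) :=
      congrArg SimplexCategory.mk (by simp; omega)
    rw [show eqToHom (ordinal_add (n + 1) (m + 1)) =
        AugmentedSimplexCategory.inclusion.map (eqToHom h) from
          (CategoryTheory.eqToHom_map AugmentedSimplexCategory.inclusion h).symm]
    refine Eq.trans ?_ (AugmentedSimplexCategory.inclusion.map_comp
      (SimplexCategory.mkHom (Fin.castAddOrderEmb (m + 1)).toOrderHom) (eqToHom h))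
    change AugmentedSimplexCategory.inclusion.map (inl' (.mk n) (.mk m)) = _
    congr 1

/-- The inclusion of the second summand of an ordinal sum, as a nondecreasing map. -/
lemma inr_ordinal (n m : ℕ) : inr (ordinal n) (ordinal m) =
    ordinalMap (Fin.natAddOrderEmb n).toOrderHom ≫ eqToHom (ordinal_add n m) := by
  rcases m with _ | m
  · exact WithInitial.starInitial.hom_ext _ _
  rcases n with _ | n
  · rw [ordinalMap_eq_eqToHom (Nat.zero_add (m + 1)).symm _ fun i => Nat.zero_add _, eqToHom_trans]
    rfl
  · have h : SimplexCategory.mk (n + 1 + m) =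
        tensorObjOf (SimplexCategory.mk n) (SimplexCategory.mk m) :=
      congrArg SimplexCategory.mk (by simp; omega)
    rw [show eqToHom (ordinal_add (n + 1) (m + 1)) =
        AugmentedSimplexCategory.inclusion.map (eqToHom h) from
          (CategoryTheory.eqToHom_map AugmentedSimplexCategory.inclusion h).symm]
    refine Eq.trans ?_ (AugmentedSimplexCategory.inclusion.map_comp
      (SimplexCategory.mkHom (n := m) (m := n + 1 + m)
        (Fin.natAddOrderEmb (m := m + 1) (n + 1)).toOrderHom) (eqToHom h))
    change AugmentedSimplexCategory.inclusion.map (inr' (.mk n) (.mk m)) = _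
    congr 1

/-- The associator of the ordinal sum is an identity up to transport. The ordinals associated in
the two ways are not definitionally equal, whence the existential quantifier. -/
lemma associator_eq (x y z : AugmentedSimplexCategory) :
    ∃ h, (α_ x y z).hom = eqToHom h := by
  rcases x with x | _ <;> rcases y with y | _ <;> rcases z with z | _
  · exact ⟨congrArg (fun j => WithInitial.of (SimplexCategory.mk j)) (by simp +arith), rfl⟩
  all_goals exact ⟨rfl, rfl⟩

lemma leftUnitor_eq (x : AugmentedSimplexCategory) : ∃ h, (λ_ x).hom = eqToHom h := by
  rcases x with x | _ <;> exact ⟨rfl, rfl⟩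

lemma rightUnitor_eq (x : AugmentedSimplexCategory) : ∃ h, (ρ_ x).hom = eqToHom h := by
  rcases x with x | _ <;> exact ⟨rfl, rfl⟩

/-- The ordinal sum of nondecreasing maps is their tensor product. -/
lemma ordinalMap_ordinalSum {n n' m m' : ℕ} (u : Fin n →o Fin m) (u' : Fin n' →o Fin m') :
    ordinalMap (ordinalSum u u' rfl rfl) ≫ eqToHom (ordinal_add m m') =
      eqToHom (ordinal_add n n') ≫ (ordinalMap u ⊗ₘ ordinalMap u') := by
  rw [← cancel_epi (eqToHom (ordinal_add n n').symm), eqToHom_trans_assoc, eqToHom_refl,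
    Category.id_comp]
  refine tensorObj_hom_ext _ _ ?_ ?_
  · rw [inl_comp_tensorHom, inl_ordinal, inl_ordinal, Category.assoc, eqToHom_trans_assoc,
      eqToHom_refl, Category.id_comp, ← Category.assoc, ← Category.assoc, ← ordinalMap_comp,
      ← ordinalMap_comp]
    congr 2
    ext i
    exact ordinalSum_left u u' rfl rfl _ i.2
  · rw [inr_comp_tensorHom, inr_ordinal, inr_ordinal, Category.assoc, eqToHom_trans_assoc,
      eqToHom_refl, Category.id_comp, ← Category.assoc, ← Category.assoc, ← ordinalMap_comp,
      ← ordinalMap_comp]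
    congr 2
    ext i
    refine (ordinalSum_right u u' rfl rfl (Fin.natAdd n i) (by simp)).trans ?_
    simp

/-- The length functor sends concatenations of 2-cells to ordinal sums. -/
lemma length_map_hcomp {s t s' t' : pt ⟶ pt} (α : s ⟶ t) (β : s' ⟶ t') :
    (length pt pt).map (X := s ≫ s') (Y := t ≫ t') (hcomp α β) ≫ eqToHom (length_comp t t') =
      eqToHom (length_comp s s') ≫ ((length pt pt).map α ⊗ₘ (length pt pt).map β) := by
  -- the lengths of the concatenations are generalized, so that the equalities can be eliminated
  suffices h : ∀ {N M : ℕ} (hN : N = len s + len s') (hM : M = len t + len t'),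
      ordinalMap (ordinalSum (lenMap α) (lenMap β) hN hM) ≫
          eqToHom ((congrArg ordinal hM).trans (ordinal_add _ _)) =
        eqToHom ((congrArg ordinal hN).trans (ordinal_add _ _)) ≫
          (ordinalMap (lenMap α) ⊗ₘ ordinalMap (lenMap β)) from h (len_comp s s') (len_comp t t')
  rintro _ _ rfl rfl
  exact ordinalMap_ordinalSum _ _

lemma eqToHom_tensorRight {x y : AugmentedSimplexCategory} (h : x = y) (z) :
    eqToHom h ▷ z = eqToHom (congrArg (· ⊗ z) h) := by
  subst h; simp

lemma eqToHom_tensorLeft {x y : AugmentedSimplexCategory} (h : x = y) (z) :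
    z ◁ eqToHom h = eqToHom (congrArg (z ⊗ ·) h) := by
  subst h; simp

/-- The length functor is strong monoidal. -/
def lengthCore : (length pt pt).CoreMonoidal where
  εIso := eqToIso (length_id pt).symm
  μIso s t := eqToIso (length_comp s t).symm
  μIso_hom_natural_left α t := by
    have h := length_map_hcomp α (𝟙 t)
    rw [CategoryTheory.Functor.map_id, MonoidalCategory.tensorHom_id] at h
    rw [← cancel_epi (eqToHom (length_comp _ _)), ← cancel_mono (eqToHom (length_comp _ _))]
    simp only [eqToIso.hom, Category.assoc, eqToHom_trans, eqToHom_trans_assoc, eqToHom_refl,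
      Category.comp_id, Category.id_comp]
    exact h.symm
  μIso_hom_natural_right t α := by
    have h := length_map_hcomp (𝟙 t) α
    rw [CategoryTheory.Functor.map_id, MonoidalCategory.id_tensorHom] at h
    rw [← cancel_epi (eqToHom (length_comp _ _)), ← cancel_mono (eqToHom (length_comp _ _))]
    simp only [eqToIso.hom, Category.assoc, eqToHom_trans, eqToHom_trans_assoc, eqToHom_refl,
      Category.comp_id, Category.id_comp]
    exact h.symm
  associativity s t r := by
    obtain ⟨h, h'⟩ := associator_eq ((length pt pt).obj s) ((length pt pt).obj t)
      ((length pt pt).obj r)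
    rw [h', show (α_ s t r).hom = eqToHom (Quiver.Path.comp_assoc s t r) from rfl,
      CategoryTheory.eqToHom_map]
    simp only [eqToIso.hom, eqToHom_tensorLeft, eqToHom_tensorRight, eqToHom_trans]
  left_unitality s := by
    obtain ⟨h, h'⟩ := leftUnitor_eq ((length pt pt).obj s)
    rw [h', show (λ_ s).hom = eqToHom (Quiver.Path.nil_comp s) from rfl, CategoryTheory.eqToHom_map]
    simp only [eqToIso.hom, eqToHom_tensorRight, eqToHom_trans]
  right_unitality s := by
    obtain ⟨h, h'⟩ := rightUnitor_eq ((length pt pt).obj s)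
    rw [h', show (ρ_ s).hom = eqToHom (Quiver.Path.comp_nil s) from rfl, CategoryTheory.eqToHom_map]
    simp only [eqToIso.hom, eqToHom_tensorLeft, eqToHom_trans]

instance : (length pt pt).Monoidal := lengthCore.toMonoidal

lemma exists_length_eq (x : AugmentedSimplexCategory) : ∃ s, (length pt pt).obj s = x := by
  obtain ⟨n, rfl⟩ := exists_ordinal_eq x
  exact ⟨path n, congrArg ordinal (len_path n)⟩

/-- The length functor as an equivalence of categories. -/
noncomputable def lengthEquivalence : (pt ⟶ pt) ≌ AugmentedSimplexCategory :=
  (length pt pt).asEquivalence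

instance : lengthEquivalence.functor.Monoidal := inferInstanceAs (length pt pt).Monoidal

noncomputable instance : lengthEquivalence.inverse.Monoidal := lengthEquivalence.inverseMonoidal

instance : lengthEquivalence.IsMonoidal where
  leftAdjoint_ε := rfl
  leftAdjoint_μ _ _ := rfl

end Length

/-! ### Homotopy monoids -/

namespace HomotopyMonoid

open Functor.OplaxMonoidal PathBicat

variable {M : Type u} [Category.{v} M] [MonoidalCategory M] (E : Base (MonoidalSingleObj M))

/-- The `𝟏`-point of a homotopy monoid `Y`, with value `Y (len s)` at the path `s`. -/
def toPoint : HomotopyMonoid E ⥤ Point One E where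
  obj Y := Point.ofOplax (length pt pt ⋙ Y.Y)
    (fun s t => E.mor_comp (E.mor_of_isIso (Y.Y.map (δ (length pt pt) s t))) (Y.δ_mem _ _))
    (E.mor_comp (E.mor_of_isIso (Y.Y.map (η (length pt pt)))) Y.η_mem)
  map {Y Z} σ := Point.homMk (fun s => σ.τ.app ((length pt pt).obj s))
    (fun α => σ.τ.naturality _)
    (fun s t => by
      have h : (Y.Y.map (δ (length pt pt) s t) ≫ δ Y.Y _ _) ≫ (σ.τ.app _ ⊗ₘ σ.τ.app _) =
          σ.τ.app _ ≫ Z.Y.map (δ (length pt pt) s t) ≫ δ Z.Y _ _ := by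
        rw [Category.assoc, σ.δ_comp, σ.τ.naturality_assoc]
      exact h)
    (by
      have h : Y.Y.map (η (length pt pt)) ≫ η Y.Y =
          σ.τ.app _ ≫ Z.Y.map (η (length pt pt)) ≫ η Z.Y := by
        rw [σ.η_comp, σ.τ.naturality_assoc]
      exact h)
  map_id Y := Point.hom_ext fun s => rfl
  map_comp σ τ := Point.hom_ext fun s => rfl

variable {E}

instance : (toPoint E).Faithful where
  map_injective {Y Z σ τ} h := by
    refine Hom.ext (NatTrans.ext (funext fun x => ?_))
    obtain ⟨s, rfl⟩ := exists_length_eq x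
    exact congrArg (fun ρ : (toPoint E).obj Y ⟶ (toPoint E).obj Z => ρ.app s) h

instance : (toPoint E).Full where
  map_surjective {Y Z} σ := by
    -- precomposition with the equivalence `length` is full, which gives the transformation
    let σ' : length pt pt ⋙ Y.Y ⟶ length pt pt ⋙ Z.Y :=
      { app := fun s => σ.app s
        naturality := fun _ _ α => σ.naturality α }
    obtain ⟨τ, hτ⟩ := ((Functor.whiskeringLeft _ _ M).obj (length pt pt)).map_surjective σ'
    have happ : ∀ s, τ.app ((length pt pt).obj s) = σ.app s := fun s =>
      congrArg (fun ρ => ρ.app s) hτ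
    refine ⟨⟨τ, fun m n => ?_, ?_⟩, Point.hom_ext happ⟩
    · obtain ⟨s, rfl⟩ := exists_length_eq m
      obtain ⟨t, rfl⟩ := exists_length_eq n
      have h := σ.app_comp s t
      rw [← happ s, ← happ t, ← happ (s ≫ t)] at h
      have h' : (Y.Y.map (δ (length pt pt) s t) ≫ δ Y.Y _ _) ≫ (τ.app _ ⊗ₘ τ.app _) =
          τ.app _ ≫ Z.Y.map (δ (length pt pt) s t) ≫ δ Z.Y _ _ := h
      rwa [Category.assoc, ← τ.naturality_assoc, cancel_epi] at h'
    · have h := σ.app_id pt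
      rw [← happ (𝟙 pt)] at h
      have h' : Y.Y.map (η (length pt pt)) ≫ η Y.Y =
          τ.app _ ≫ Z.Y.map (η (length pt pt)) ≫ η Z.Y := h
      rwa [← τ.naturality_assoc, cancel_epi] at h'

instance : (toPoint E).EssSurj where
  mem_essImage F := by
    -- the point, as a colax monoidal functor on paths, composed with the inverse of `length`
    let Y : HomotopyMonoid E :=
      { Y := lengthEquivalence.inverse ⋙ F.functor
        δ_mem := fun m n =>
          E.mor_comp (E.mor_of_isIso (F.functor.map (δ lengthEquivalence.inverse m n)))
            (F.φ_mem _ _)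
        η_mem :=
          E.mor_comp (E.mor_of_isIso (F.functor.map (η lengthEquivalence.inverse))) (F.φ₀_mem _) }
    refine ⟨Y, ⟨(Point.isoMkOne (F := F) (G := (toPoint E).obj Y)
      (fun s => F.functor.mapIso (lengthEquivalence.unitIso.app s)) (fun {s t} α => ?_)
      (fun s t => ?_) ?_).symm⟩⟩
    · exact (F.functor.map_comp _ _).symm.trans
        ((congrArg F.functor.map (lengthEquivalence.unitIso.hom.naturality α)).trans
          (F.functor.map_comp _ _))
    · have h : δ F.functor s t ≫ (F.functor.map (lengthEquivalence.unit.app s) ⊗ₘ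
            F.functor.map (lengthEquivalence.unit.app t)) =
          F.functor.map (lengthEquivalence.unit.app (s ⊗ t)) ≫
            F.functor.map (lengthEquivalence.inverse.map (δ lengthEquivalence.functor s t)) ≫
              F.functor.map (δ lengthEquivalence.inverse _ _) ≫ δ F.functor _ _ := by
        rw [δ_natural, ← Functor.map_comp_assoc, ← Functor.map_comp_assoc,
          Equivalence.unit_app_tensor_comp_inverse_map_δ_functor, Category.assoc,
          Functor.Monoidal.μ_δ]
        exact congrArg (fun f => F.functor.map f ≫ _) (Category.comp_id _).symm
      exact h
    · have h : η F.functor = F.functor.map (lengthEquivalence.unit.app (𝟙_ (pt ⟶ pt))) ≫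
            F.functor.map (lengthEquivalence.inverse.map (η lengthEquivalence.functor)) ≫
              F.functor.map (η lengthEquivalence.inverse) ≫ η F.functor := by
        rw [← Functor.map_comp_assoc, ← Functor.map_comp_assoc,
          Equivalence.unit_app_comp_inverse_map_η_functor, Functor.Monoidal.ε_η]
        exact ((congrArg (· ≫ η F.functor) (F.functor.map_id _)).trans (Category.id_comp _)).symm
      exact h

instance : (toPoint E).IsEquivalence where

end HomotopyMonoid

/-- The equivalence is inverse to `HomotopyMonoid.toPoint`, and `θ` consists of the components of
the inverse of its unit; the identities are the laws of morphisms of points for these components. -/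
theorem exists_equivalence_homotopyMonoid {M : Type u} [Category.{v} M] [MonoidalCategory M]
      (W : Base (MonoidalSingleObj M)) :
      ∃ (e : Point One W ≌ HomotopyMonoid W)
        (θ : ∀ (F : Point One W) (s : pt ⟶ pt),
          (e.functor.obj F).Y.obj ((PathBicat.length _ _).obj s) ≅ F.obj s),
        (∀ {F G} (σ : F ⟶ G) (s : pt ⟶ pt),
          (e.functor.map σ).τ.app _ ≫ (θ G s).hom = (θ F s).hom ≫ σ.app s) ∧
        (∀ F {s t : pt ⟶ pt} (α : s ⟶ t),
          (e.functor.obj F).Y.map ((PathBicat.length _ _).map α) ≫ (θ F t).hom =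
            (θ F s).hom ≫ F.map α) ∧
        (∀ F (s t : pt ⟶ pt),
          (e.functor.obj F).Y.map (eqToHom (PathBicat.length_comp s t)) ≫
              Functor.OplaxMonoidal.δ (e.functor.obj F).Y _ _ ≫ ((θ F s).hom ⊗ₘ (θ F t).hom) =
            (θ F (s ≫ t)).hom ≫ F.φ s t) ∧
        (∀ F, (e.functor.obj F).Y.map (eqToHom (PathBicat.length_id pt)) ≫
              Functor.OplaxMonoidal.η (e.functor.obj F).Y =
            (θ F (𝟙 pt)).hom ≫ F.φ₀ pt) := by
  let e := (HomotopyMonoid.toPoint W).asEquivalence.symm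
  refine ⟨e, fun F s => Point.appIso (e.unitIso.symm.app F) s, fun {F G} σ s => ?_,
    fun F {s t} α => ?_, fun F s t => ?_, fun F => ?_⟩
  · exact congrArg (fun ρ => Point.Hom.app ρ s) (e.unitIso.inv.naturality σ)
  · exact (e.unitIso.inv.app F).naturality α
  · rw [← Category.assoc]
    exact (e.unitIso.inv.app F).app_comp s t
  · exact (e.unitIso.inv.app F).app_id pt

/-! ### Simplicial objects as points -/

namespace PathBicat

lemma simplexHom_ext {n m : ℕ} {f g : SimplexCategory.mk n ⟶ SimplexCategory.mk m}
    (h : ∀ (j : ℕ) (hj : j < n + 1),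
      (f.toOrderHom ⟨j, hj⟩ : ℕ) = g.toOrderHom ⟨j, hj⟩) : f = g := by
  ext i : 3
  exact Fin.ext (h i i.2)

section

variable {C : Type u} [Category.{v} C] {A B D K : PathBicat C}

lemma vertexMap_id (s : A ⟶ B) : vertexMap (𝟙 s) = 𝟙 _ :=
  simplexHom_ext fun j hj => cut_lenMap_id s (by omega)

lemma vertexMap_comp {s t r : A ⟶ B} (α : s ⟶ t) (β : t ⟶ r) :
    vertexMap (α ≫ β) = vertexMap β ≫ vertexMap α :=
  simplexHom_ext fun j _ => cut_lenMap_comp α β j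

lemma initialSegment_vertexMap_hcomp {s t : A ⟶ B} {s' t' : B ⟶ D} (α : s ⟶ t) (β : s' ⟶ t') :
    initialSegment t t' ≫ vertexMap (s := s ≫ s') (t := t ≫ t') (hcomp α β) =
      vertexMap α ≫ initialSegment s s' :=
  simplexHom_ext fun j hj => cut_lenMap_hcomp_left α β (j := j) (by omega)

lemma finalSegment_vertexMap_hcomp {s t : A ⟶ B} {s' t' : B ⟶ D} (α : s ⟶ t) (β : s' ⟶ t') :
    finalSegment t t' ≫ vertexMap (s := s ≫ s') (t := t ≫ t') (hcomp α β) =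
      vertexMap β ≫ finalSegment s s' :=
  simplexHom_ext fun j _ => cut_lenMap_hcomp_right α β j

lemma cut_lenMap_associator (s : A ⟶ B) (t : B ⟶ D) (r : D ⟶ K) {j : ℕ}
    (hj : j ≤ len s + (len t + len r)) :
    cut (lenMap (Bicategory.associator s t r).hom) j = j :=
  cut_lenMap_eqToHom (t := s ≫ t ≫ r) (Quiver.Path.comp_assoc s t r)
    (by rwa [len_comp, len_comp])

lemma initialSegment_vertexMap_associator (s : A ⟶ B) (t : B ⟶ D) (r : D ⟶ K) :
    initialSegment s (t ≫ r) ≫ vertexMap (Bicategory.associator s t r).hom =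
      initialSegment s t ≫ initialSegment (s ≫ t) r :=
  simplexHom_ext fun j hj => cut_lenMap_associator s t r (j := j) (by omega)

lemma initial_finalSegment_vertexMap_associator (s : A ⟶ B) (t : B ⟶ D) (r : D ⟶ K) :
    initialSegment t r ≫ finalSegment s (t ≫ r) ≫ vertexMap (Bicategory.associator s t r).hom =
      finalSegment s t ≫ initialSegment (s ≫ t) r :=
  simplexHom_ext fun j hj => cut_lenMap_associator s t r (j := len s + j) (by omega)

lemma final_finalSegment_vertexMap_associator (s : A ⟶ B) (t : B ⟶ D) (r : D ⟶ K) :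
    finalSegment t r ≫ finalSegment s (t ≫ r) ≫ vertexMap (Bicategory.associator s t r).hom =
      finalSegment (s ≫ t) r :=
  simplexHom_ext fun j hj =>
    (cut_lenMap_associator s t r (j := len s + (len t + j)) (by omega)).trans
      ((Nat.add_assoc _ _ _).symm.trans (congrArg (· + j) (len_comp s t).symm))

lemma vertexMap_leftUnitor (s : A ⟶ B) :
    vertexMap (Bicategory.leftUnitor s).hom = finalSegment (𝟙 A) s :=
  simplexHom_ext fun j _ => (cut_lenMap_eqToHom (Quiver.Path.nil_comp s) (by omega)).trans
    (Nat.zero_add j).symm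

lemma vertexMap_rightUnitor (s : A ⟶ B) :
    vertexMap (Bicategory.rightUnitor s).hom = initialSegment s (𝟙 B) :=
  simplexHom_ext fun j _ => cut_lenMap_eqToHom (Quiver.Path.comp_nil s) (by omega)

end

end PathBicat

namespace Simplicial

open PathBicat CartesianMonoidalCategory

variable {M : Type u} [Category.{v} M] [CartesianMonoidalCategory M]

section

variable {C : Type u₁} [Category.{v₁} C] (X : SimplicialObject M) {A B D : PathBicat C}

/-- The colaxity map whose components are the restrictions to the initial and final segments. -/
def segments (s : A ⟶ B) (t : B ⟶ D) : X.obj (op (.mk (len (s ≫ t)))) ⟶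
    X.obj (op (.mk (len s))) ⊗ X.obj (op (.mk (len t))) :=
  lift (X.map (initialSegment s t).op) (X.map (finalSegment s t).op)

lemma map_hcomp_segments {s s' : A ⟶ B} {t t' : B ⟶ D} (α : s ⟶ s') (β : t ⟶ t') :
    X.map (vertexMap (s := s ≫ t) (t := s' ≫ t') (hcomp α β)).op ≫ segments X s' t' =
      segments X s t ≫ (X.map (vertexMap α).op ⊗ₘ X.map (vertexMap β).op) := by
  rw [segments, segments, comp_lift, lift_map, ← X.map_comp, ← X.map_comp, ← X.map_comp,
    ← X.map_comp, ← op_comp, ← op_comp, ← op_comp, ← op_comp, initialSegment_vertexMap_hcomp,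
    finalSegment_vertexMap_hcomp]

end

/-- The point of a simplicial object `X`, with value `X (len s)` at the path `s`. -/
def toPoint : SimplicialObject M ⥤ Point One (Base.all (MonoidalSingleObj M)) where
  obj X := Point.mk' (fun s => X.obj (op (.mk (len s)))) (fun α => X.map (vertexMap α).op)
    (fun s t => segments X s t) (fun A => toUnit _)
    (fun s => by rw [vertexMap_id, op_id, X.map_id])
    (fun α β => by rw [vertexMap_comp, op_comp, X.map_comp])
    (fun α t => by
      have h := map_hcomp_segments X α (𝟙 t)
      rw [vertexMap_id, op_id, X.map_id, tensorHom_id] at h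
      exact h)
    (fun s _ _ α => by
      have h := map_hcomp_segments X (𝟙 s) α
      rw [vertexMap_id, op_id, X.map_id, id_tensorHom] at h
      exact h)
    (fun s t r => by
      ext
      · simp [segments, ← Functor.map_comp, ← op_comp, initialSegment_vertexMap_associator]
      · simp [segments, ← Functor.map_comp, ← op_comp, initial_finalSegment_vertexMap_associator]
      · simp [segments, ← Functor.map_comp, ← op_comp, final_finalSegment_vertexMap_associator])
    (fun s => by simp [segments, vertexMap_leftUnitor])
    (fun s => by simp [segments, vertexMap_rightUnitor])
    (fun _ _ => trivial) (fun _ => trivial)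
  map {X Z} τ := Point.homMk (fun s => τ.app (op (.mk (len s))))
    (fun α => τ.naturality _)
    (fun s t => by
      have h : segments X s t ≫ (τ.app _ ⊗ₘ τ.app _) = τ.app _ ≫ segments Z s t := by
        simp [segments]
      exact h)
    (toUnit_unique _ _)
  map_id X := Point.hom_ext fun s => rfl
  map_comp σ τ := Point.hom_ext fun s => rfl

lemma exists_op_len_eq (Δ : SimplexCategoryᵒᵖ) : ∃ s : pt ⟶ pt, op (.mk (len s)) = Δ :=
  ⟨path Δ.unop.len, by rw [len_path]⟩

instance : (toPoint (M := M)).Faithful where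
  map_injective {X Z σ τ} h := by
    refine NatTrans.ext (funext fun Δ => ?_)
    obtain ⟨s, rfl⟩ := exists_op_len_eq Δ
    exact congrArg (fun ρ : toPoint.obj X ⟶ toPoint.obj Z => ρ.app s) h

/-- A factorization of a function `g : {0, …, len t} → {0, …, len s}` as an endpoint-preserving
map, given by a 2-cell `α : p ⟶ t`, and the inclusion of the interval of vertices of the middle part
`p` of `s`. -/
structure Factorization (s t : pt ⟶ pt) (g : ℕ → ℕ) where
  /-- the part of `s` before the interval -/
  r : pt ⟶ pt
  /-- the part of `s` on the interval -/
  p : pt ⟶ pt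
  /-- the part of `s` after the interval -/
  q : pt ⟶ pt
  eq : s = (r ≫ p) ≫ q
  /-- the 2-cell dual to the endpoint-preserving map -/
  α : p ⟶ t
  spec : ∀ j ≤ len t, g j = len r + cut (lenMap α) j

lemma Factorization.nonempty {s t : pt ⟶ pt} (g : ℕ → ℕ)
    (hg : ∀ i j, i ≤ j → j ≤ len t → g i ≤ g j) (hle : g (len t) ≤ len s) :
    Nonempty (Factorization s t g) := by
  obtain ⟨rp, q, rfl, hrp⟩ := exists_split s (g (len t)) hle
  obtain ⟨r, p, rfl, hr⟩ := exists_split rp (g 0) (hrp ▸ hg _ _ (Nat.zero_le _) le_rfl)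
  rw [len_comp] at hrp
  obtain ⟨u, hu⟩ := exists_cut_eq (n := len p) (m := len t) (fun j => g j - len r)
    (fun i j hij hj => Nat.sub_le_sub_right (hg i j hij hj) _) (Nat.sub_eq_zero_of_le hr.ge)
    (by omega)
  refine ⟨r, p, q, rfl, cellMk u, fun j hj => ?_⟩
  have h := hg 0 j (Nat.zero_le _) hj
  rw [lenMap_cellMk, hu j hj]
  omega

/-- A function on vertices has only one factorization: the interval is determined by the values at
the endpoints, and the 2-cell by its cuts. -/
instance {s t : pt ⟶ pt} {g : ℕ → ℕ} : Subsingleton (Factorization s t g) where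
  allEq := by
    rintro ⟨r, p, q, rfl, α, hα⟩ ⟨r', p', q', h, α', hα'⟩
    have h0 := hα 0 (Nat.zero_le _)
    have h0' := hα' 0 (Nat.zero_le _)
    have h1 := hα (len t) le_rfl
    have h1' := hα' (len t) le_rfl
    rw [cut_zero] at h0 h0'
    rw [cut_of_le _ le_rfl] at h1 h1'
    have hl := congrArg len h
    simp only [len_comp] at hl
    obtain rfl : r = r' := path_ext (by omega)
    obtain rfl : p = p' := path_ext (by omega)
    obtain rfl : q = q' := path_ext (by omega)
    obtain rfl : α = α' := cell_ext_cut fun j hj => by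
      have := hα j hj
      have := hα' j hj
      omega
    rfl

/-- The function on natural numbers that extends a map of simplices by zero. -/
def onNat {Δ Δ' : SimplexCategory} (f : Δ ⟶ Δ') (j : ℕ) : ℕ :=
  if h : j < Δ.len + 1 then (f.toOrderHom ⟨j, h⟩ : ℕ) else 0

lemma onNat_of_le {Δ Δ' : SimplexCategory} (f : Δ ⟶ Δ') {j : ℕ} (h : j ≤ Δ.len) :
    onNat f j = f.toOrderHom ⟨j, Nat.lt_succ_of_le h⟩ :=
  dif_pos _

lemma nonempty_factorization_onNat {Δ Δ' : SimplexCategory} (f : Δ ⟶ Δ') {s t : pt ⟶ pt}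
    (hs : len s = Δ'.len) (ht : len t = Δ.len) : Nonempty (Factorization s t (onNat f)) := by
  refine Factorization.nonempty _ (fun i j hij hj => ?_) ?_
  · rw [onNat_of_le f (by omega), onNat_of_le f (by omega)]
    exact f.toOrderHom.monotone hij
  · rw [onNat_of_le f (by omega), hs]
    exact Nat.le_of_lt_succ (Fin.is_lt _)

/-- Every map of simplices is an endpoint-preserving map followed by the inclusion of an interval.
-/
lemma exists_factorization {s t : pt ⟶ pt} (f : SimplexCategory.mk (len t) ⟶ .mk (len s)) :
    ∃ (r p q : pt ⟶ pt) (h : s = (r ≫ p) ≫ q) (α : p ⟶ t),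
      f = vertexMap α ≫ finalSegment r p ≫ initialSegment (r ≫ p) q ≫ eqToHom (by rw [h]) := by
  obtain ⟨r, p, q, rfl, α, h⟩ := (nonempty_factorization_onNat f (s := s) (t := t) rfl rfl).some
  refine ⟨r, p, q, rfl, α, simplexHom_ext fun j hj => ?_⟩
  have hj' := Nat.le_of_lt_succ hj
  rw [eqToHom_refl, Category.comp_id]
  exact (onNat_of_le f hj').symm.trans (h j hj')

/-- The components of a morphism of points, indexed by simplices instead of paths. -/
def extend {X Z : SimplicialObject M} (σ : toPoint.obj X ⟶ toPoint.obj Z) (Δ : SimplexCategoryᵒᵖ) :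
    X.obj Δ ⟶ Z.obj Δ :=
  have h : op (.mk (len (path Δ.unop.len))) = Δ := by rw [len_path]
  X.map (eqToHom h.symm) ≫ σ.app (path Δ.unop.len) ≫ Z.map (eqToHom h)

lemma extend_op_len {X Z : SimplicialObject M} (σ : toPoint.obj X ⟶ toPoint.obj Z) (s : pt ⟶ pt) :
    extend σ (op (.mk (len s))) = σ.app s := by
  -- the path `path (len s)` is generalized to a path `s'` equal to `s`
  suffices h : ∀ (g : ∀ s : pt ⟶ pt, X.obj (op (.mk (len s))) ⟶ Z.obj (op (.mk (len s))))
      (s' : pt ⟶ pt) (_ : s' = s) (h : op (SimplexCategory.mk (len s')) = op (.mk (len s))),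
      X.map (eqToHom h.symm) ≫ g s' ≫ Z.map (eqToHom h) = g s from
    h (fun s => σ.app s) _ (path_len s) _
  rintro g s' rfl h
  simp

instance : (toPoint (M := M)).Full where
  map_surjective {X Z} σ := by
    refine ⟨⟨extend σ, fun Δ Δ' f => ?_⟩, Point.hom_ext (extend_op_len σ)⟩
    obtain ⟨s, rfl⟩ := exists_op_len_eq Δ
    obtain ⟨t, rfl⟩ := exists_op_len_eq Δ'
    -- naturality holds for endpoint-preserving maps because `σ` is natural, and for inclusions of
    -- initial and final segments because `σ` is compatible with the colaxity maps
    have hnat : ∀ {s t : pt ⟶ pt} (α : s ⟶ t),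
        X.map (vertexMap α).op ≫ extend σ (op (.mk (len t))) =
        extend σ (op (.mk (len s))) ≫ Z.map (vertexMap α).op := fun {s t} α => by
      rw [extend_op_len, extend_op_len]
      exact σ.naturality α
    have hφ : ∀ s t : pt ⟶ pt, segments X s t ≫
        (extend σ (op (.mk (len s))) ⊗ₘ extend σ (op (.mk (len t)))) =
        extend σ (op (.mk (len (s ≫ t)))) ≫ segments Z s t := fun s t => by
      rw [extend_op_len, extend_op_len, extend_op_len]
      exact σ.app_comp s t
    have hinit : ∀ s t : pt ⟶ pt, X.map (initialSegment s t).op ≫ extend σ _ =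
        extend σ _ ≫ Z.map (initialSegment s t).op := fun s t => by
      simpa [segments] using congrArg (· ≫ fst _ _) (hφ s t)
    have hfin : ∀ s t : pt ⟶ pt, X.map (finalSegment s t).op ≫ extend σ _ =
        extend σ _ ≫ Z.map (finalSegment s t).op := fun s t => by
      simpa [segments] using congrArg (· ≫ snd _ _) (hφ s t)
    obtain ⟨f, rfl⟩ : ∃ f', f = Quiver.Hom.op f' := ⟨f.unop, rfl⟩
    obtain ⟨r, p, q, rfl, α, rfl⟩ := exists_factorization f
    simp only [eqToHom_refl, Category.comp_id, op_comp, Functor.map_comp, Category.assoc]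
    rw [hnat, reassoc_of% (hfin r p), reassoc_of% (hinit (r ≫ p) q)]

end Simplicial

/-! ### The simplicial object of a point -/

namespace Simplicial

open PathBicat CartesianMonoidalCategory

variable {M : Type u} [Category.{v} M] [CartesianMonoidalCategory M]
  {E : Base (MonoidalSingleObj M)} (F : Point One E)

/-- The restriction of the value of a point to an initial part `s` of the path `a`. -/
def init {a s t : pt ⟶ pt} (h : a = s ≫ t) : F.obj a ⟶ F.obj s :=
  F.map (eqToHom h) ≫ F.φ s t ≫ fst _ _

/-- The restriction of the value of a point to a final part `t` of the path `a`. -/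
def fin {a s t : pt ⟶ pt} (h : a = s ≫ t) : F.obj a ⟶ F.obj t :=
  F.map (eqToHom h) ≫ F.φ s t ≫ snd _ _

lemma eqToHom_map_init_assoc {a s t : pt ⟶ pt} (h : a = s ≫ t) {Z : M} (f : F.obj s ⟶ Z) :
    F.map (eqToHom h.symm) ≫ init F h ≫ f = F.φ s t ≫ fst _ _ ≫ f := by
  subst h
  simp [init]

lemma eqToHom_map_fin_assoc {a s t : pt ⟶ pt} (h : a = s ≫ t) {Z : M} (f : F.obj t ⟶ Z) :
    F.map (eqToHom h.symm) ≫ fin F h ≫ f = F.φ s t ≫ snd _ _ ≫ f := by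
  subst h
  simp [fin]

lemma map_init {s s' t t' : pt ⟶ pt} (α : s ⟶ s') (β : t ⟶ t') :
    F.map (Bicategory.whiskerRight α t ≫ Bicategory.whiskerLeft s' β) ≫
      init F (rfl : s' ≫ t' = s' ≫ t') = init F rfl ≫ F.map α := by
  have h := congrArg (· ≫ fst _ _) (F.map_hcomp_φ α β)
  simpa [init] using h

lemma map_fin {s s' t t' : pt ⟶ pt} (α : s ⟶ s') (β : t ⟶ t') :
    F.map (Bicategory.whiskerRight α t ≫ Bicategory.whiskerLeft s' β) ≫
      fin F (rfl : s' ≫ t' = s' ≫ t') = fin F rfl ≫ F.map β := by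
  have h := congrArg (· ≫ snd _ _) (F.map_hcomp_φ α β)
  simpa [fin] using h

lemma map_eqToHom_φ_whiskerLeft_φ {s t r : pt ⟶ pt} (h : (s ≫ t) ≫ r = s ≫ t ≫ r) :
    F.map (eqToHom h) ≫ F.φ s (t ≫ r) ≫ F.obj s ◁ F.φ t r =
      F.φ (s ≫ t) r ≫ F.φ s t ▷ F.obj r ≫ (α_ (F.obj s) (F.obj t) (F.obj r)).hom :=
  F.map_associator_φ s t r

/-- The restriction to the initial part of an initial part. -/
lemma init_init {a s t r st tr : pt ⟶ pt} (h₁ : a = s ≫ tr) (h₂ : tr = t ≫ r) (h₃ : a = st ≫ r)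
    (h₄ : st = s ≫ t) : init F h₃ ≫ init F h₄ = init F h₁ := by
  subst h₂ h₄ h₃
  have h := congrArg (· ≫ fst _ _) (map_eqToHom_φ_whiskerLeft_φ F h₁)
  simpa [init] using h.symm

/-- The restriction to a middle part does not depend on the order in which the two ends are removed.
-/
lemma init_fin {a s t r st tr : pt ⟶ pt} (h₁ : a = s ≫ tr) (h₂ : tr = t ≫ r) (h₃ : a = st ≫ r)
    (h₄ : st = s ≫ t) : init F h₃ ≫ fin F h₄ = fin F h₁ ≫ init F h₂ := by
  subst h₂ h₄ h₃
  have h := congrArg (· ≫ snd _ _ ≫ fst _ _) (map_eqToHom_φ_whiskerLeft_φ F h₁)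
  simpa [init, fin] using h.symm

/-- The restriction to the final part of a final part. -/
lemma fin_fin {a s t r st tr : pt ⟶ pt} (h₁ : a = s ≫ tr) (h₂ : tr = t ≫ r) (h₃ : a = st ≫ r)
    (h₄ : st = s ≫ t) : fin F h₁ ≫ fin F h₂ = fin F h₃ := by
  subst h₂ h₄ h₃
  have h := congrArg (· ≫ snd _ _ ≫ snd _ _) (map_eqToHom_φ_whiskerLeft_φ F h₁)
  simpa [fin] using h

lemma init_comp_map_eqToHom {a s s' t t' : pt ⟶ pt} (h : a = s ≫ t) (hs : s = s') (ht : t = t') :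
    init F h ≫ F.map (eqToHom hs) = init F (h.trans (by rw [hs, ht] : s ≫ t = s' ≫ t')) := by
  subst hs ht
  simp

lemma whiskerRight_leftUnitor {X Y : M} (f : X ⟶ 𝟙_ M) : f ▷ Y ≫ (λ_ Y).hom = snd X Y := by
  rw [← whiskerRight_snd f, leftUnitor_hom]

lemma whiskerLeft_rightUnitor {X Y : M} (f : X ⟶ 𝟙_ M) : Y ◁ f ≫ (ρ_ Y).hom = fst Y X := by
  rw [← whiskerLeft_fst Y f, rightUnitor_hom]

/-- By the unit law, the restriction that removes an empty final part is trivial. -/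
lemma init_nil {a s : pt ⟶ pt} (h : a = s ≫ 𝟙 pt) (h' : a = s) : init F h = F.map (eqToHom h') := by
  rw [init, ← whiskerLeft_rightUnitor (F.φ₀ pt), ← F.map_rightUnitor s, ← F.map_comp]
  exact congrArg F.map (eqToHom_trans h (Quiver.Path.comp_nil s))

/-- By the unit law, the restriction that removes an empty initial part is trivial. -/
lemma fin_nil {a s : pt ⟶ pt} (h : a = 𝟙 pt ≫ s) (h' : a = s) : fin F h = F.map (eqToHom h') := by
  subst h
  rw [show eqToHom h' = (Bicategory.leftUnitor s).hom from rfl, F.map_leftUnitor s,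
    whiskerRight_leftUnitor, fin, eqToHom_refl, Point.map_id, Category.id_comp]

namespace Factorization

/-- The map between values of a point induced by a function between vertices. -/
def map {s t : pt ⟶ pt} {g : ℕ → ℕ} (x : Factorization s t g) : F.obj s ⟶ F.obj t :=
  init F x.eq ≫ fin F rfl ≫ F.map x.α

/-- The composite of two factorizations: the second interval is pulled back along the 2-cell of the
first. -/
lemma map_comp_map {s t t' : pt ⟶ pt} {g g' g'' : ℕ → ℕ} (x : Factorization s t g)
    (y : Factorization t t' g') (z : Factorization s t' g'')
    (h : ∀ j ≤ len t', g'' j = g (g' j)) : x.map F ≫ y.map F = z.map F := by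
  obtain ⟨r, p, q, rfl, α, hα⟩ := x
  obtain ⟨r', p', q', rfl, β, hβ⟩ := y
  -- the middle part `p` of the first factorization is cut into the preimages of `r'`, `p'`, `q'`
  obtain ⟨p₁₂, p₃, rfl, α₁₂, α₃, rfl⟩ := exists_hcomp α
  obtain ⟨p₁, p₂, rfl, α₁, α₂, rfl⟩ := exists_hcomp α₁₂
  simp only [eqToHom_refl, Category.id_comp] at hα
  have e₁ : (r ≫ (p₁ ≫ p₂) ≫ p₃) ≫ q = ((r ≫ p₁) ≫ p₂) ≫ p₃ ≫ q := path_ext (by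
    simp only [len_comp]; omega)
  obtain rfl : z = ⟨r ≫ p₁, p₂, p₃ ≫ q, e₁, α₂ ≫ β, fun j hj => by
      have hc := cut_le (lenMap β) j
      rw [h j hj, hβ j hj, hα _ (by rw [len_comp, len_comp]; omega), cut_lenMap_comp α₂,
        whiskerRight_comp_whiskerLeft, whiskerRight_comp_whiskerLeft,
        cut_lenMap_hcomp_left _ _ (by rw [len_comp]; omega), cut_lenMap_hcomp_right, len_comp,
        Nat.add_assoc]⟩ := Subsingleton.elim _ _
  simp only [map, eqToHom_refl, Category.id_comp, Category.assoc]
  have key : F.map (Bicategory.whiskerRight (Bicategory.whiskerRight α₁ p₂ ≫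
        Bicategory.whiskerLeft r' α₂) p₃ ≫ Bicategory.whiskerLeft (r' ≫ p') α₃) ≫
      init F rfl ≫ fin F rfl = init F rfl ≫ fin F rfl ≫ F.map α₂ := by
    rw [← Category.assoc, map_init, Category.assoc, map_fin]
  have e₂ : r ≫ (p₁ ≫ p₂) ≫ p₃ = ((r ≫ p₁) ≫ p₂) ≫ p₃ := path_ext (by
    simp only [len_comp]; omega)
  have e₃ : (r ≫ p₁) ≫ p₂ = r ≫ p₁ ≫ p₂ := path_ext (by simp only [len_comp]; omega)
  rw [reassoc_of% key, F.map_comp, ← reassoc_of% (init_fin F rfl rfl e₂ e₃),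
    ← reassoc_of% (fin_fin F e₃ rfl rfl rfl), ← reassoc_of% (init_init F e₁ rfl rfl e₂)]

/-- A function that comes from a 2-cell induces the value of the point at the 2-cell. -/
lemma map_eq_map {s t : pt ⟶ pt} {g : ℕ → ℕ} (x : Factorization s t g) (α : s ⟶ t)
    (h : ∀ j ≤ len t, g j = cut (lenMap α) j) : x.map F = F.map α := by
  obtain rfl : x = ⟨𝟙 pt, s, 𝟙 pt, path_ext (by simp only [len_comp]; exact (Nat.zero_add _).symm),
    α, fun j hj => (h j hj).trans (Nat.zero_add _).symm⟩ := Subsingleton.elim _ _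
  have e : 𝟙 pt ≫ s = s := path_ext (by rw [len_comp]; exact Nat.zero_add _)
  rw [map, init_nil F _ e.symm, fin_nil F _ e, ← F.map_comp, ← F.map_comp, eqToHom_trans_assoc,
    eqToHom_refl, Category.id_comp]

lemma map_eq_init {s t a b : pt ⟶ pt} {g : ℕ → ℕ} (x : Factorization a b g) (ha : a = s ≫ t)
    (hb : s = b) (h : ∀ j ≤ len b, g j = j) : x.map F = init F ha ≫ F.map (eqToHom hb) := by
  subst hb
  have e : s = 𝟙 pt ≫ s := path_ext (by rw [len_comp]; exact (Nat.zero_add _).symm)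
  obtain rfl : x = ⟨𝟙 pt, s, t, by rw [← e, ha], 𝟙 s, fun j hj => by
    rw [h j hj, cut_lenMap_id _ hj]; exact (Nat.zero_add _).symm⟩ := Subsingleton.elim _ _
  rw [map, fin_nil F _ e.symm, eqToHom_refl, Point.map_id, Category.comp_id, Category.comp_id]
  exact init_comp_map_eqToHom F _ e.symm rfl

lemma map_eq_fin {s t a b : pt ⟶ pt} {g : ℕ → ℕ} (x : Factorization a b g) (ha : a = s ≫ t)
    (hb : t = b) (h : ∀ j ≤ len b, g j = len s + j) : x.map F = fin F ha ≫ F.map (eqToHom hb) := by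
  subst hb
  obtain rfl : x = ⟨s, t, 𝟙 pt, ha.trans (path_ext (by rw [len_comp _ (𝟙 pt)]; rfl)), 𝟙 t,
    fun j hj => by rw [h j hj, cut_lenMap_id _ hj]⟩ := Subsingleton.elim _ _
  subst ha
  rw [map, init_nil F _ rfl]
  simp

end Factorization

/-- The simplicial object of a point: a map of simplices acts through its factorization. -/
noncomputable def ofPoint : SimplicialObject M where
  obj Δ := F.obj (path Δ.unop.len)
  map f := (nonempty_factorization_onNat f.unop (len_path _) (len_path _)).some.map F
  map_id Δ := by
    rw [Factorization.map_eq_map F _ (𝟙 _), F.map_id]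
    intro j hj
    rw [cut_lenMap_id _ hj, onNat_of_le _ (by rwa [len_path] at hj)]
    rfl
  map_comp {Δ Δ' Δ''} f g := by
    symm
    refine Factorization.map_comp_map F _ _ _ fun j hj => ?_
    rw [len_path] at hj
    rw [onNat_of_le _ hj, onNat_of_le _ hj, onNat_of_le _ (Nat.le_of_lt_succ (Fin.is_lt _))]
    rfl

lemma ofPoint_map_vertexMap {s t : pt ⟶ pt} (α : s ⟶ t) : (ofPoint F).map (vertexMap α).op =
    F.map (eqToHom (path_len s) ≫ α ≫ eqToHom (path_len t).symm) := by
  refine Factorization.map_eq_map F _ _ fun j hj => ?_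
  have hj' : j ≤ len t := by rwa [path_len] at hj
  rw [cut_lenMap_comp, cut_lenMap_comp, cut_lenMap_eqToHom _ hj,
    cut_lenMap_eqToHom _ (cut_le _ _)]
  exact onNat_of_le _ hj'

lemma ofPoint_map_initialSegment (s t : pt ⟶ pt) : (ofPoint F).map (initialSegment s t).op =
    init F (path_len (s ≫ t)) ≫ F.map (eqToHom (path_len s).symm) :=
  Factorization.map_eq_init F _ _ _ fun j hj => by
    have hj' : j ≤ len s := by rwa [path_len] at hj
    exact onNat_of_le _ hj'

lemma ofPoint_map_finalSegment (s t : pt ⟶ pt) : (ofPoint F).map (finalSegment s t).op =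
    fin F (path_len (s ≫ t)) ≫ F.map (eqToHom (path_len t).symm) :=
  Factorization.map_eq_fin F _ _ _ fun j hj => by
    have hj' : j ≤ len t := by rwa [path_len] at hj
    exact onNat_of_le _ hj'

/-- Both sides are maps into a product; the hypotheses compare their components. -/
lemma comp_tensor_eq_comp_lift {X Y Z X' Y' Z' : M} {φ : X ⟶ Y ⊗ Z} {f : X' ⟶ Y'} {g : X' ⟶ Z'}
    {x : X ⟶ X'} {y : Y ⟶ Y'} {z : Z ⟶ Z'} (h₁ : φ ≫ fst _ _ ≫ y = x ≫ f)
    (h₂ : φ ≫ snd _ _ ≫ z = x ≫ g) : φ ≫ (y ⊗ₘ z) = x ≫ lift f g := by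
  ext
  · rw [Category.assoc, Category.assoc, lift_fst, tensorHom_fst, h₁]
  · rw [Category.assoc, Category.assoc, lift_snd, tensorHom_snd, h₂]

lemma comp_fst_of_lift_comp {X Y Z X' Y' Z' : M} {f : X ⟶ Y} {g : X ⟶ Z} {φ : X' ⟶ Y' ⊗ Z'}
    {x : X ⟶ X'} {y : Y ⟶ Y'} {z : Z ⟶ Z'} (h : lift f g ≫ (y ⊗ₘ z) = x ≫ φ) :
    x ≫ φ ≫ fst _ _ = f ≫ y := by
  rw [← Category.assoc, ← h, lift_map, lift_fst]

lemma comp_snd_of_lift_comp {X Y Z X' Y' Z' : M} {f : X ⟶ Y} {g : X ⟶ Z} {φ : X' ⟶ Y' ⊗ Z'}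
    {x : X ⟶ X'} {y : Y ⟶ Y'} {z : Z ⟶ Z'} (h : lift f g ≫ (y ⊗ₘ z) = x ≫ φ) :
    x ≫ φ ≫ snd _ _ = g ≫ z := by
  rw [← Category.assoc, ← h, lift_map, lift_snd]

instance : (toPoint (M := M)).EssSurj where
  mem_essImage F := by
    refine ⟨ofPoint F, ⟨(Point.isoMkOne (F := F) (G := toPoint.obj (ofPoint F))
      (fun s => F.functor.mapIso (eqToIso (path_len s).symm)) (fun {s t} α => ?_)
      (fun s t => ?_) (toUnit_unique _ _)).symm⟩⟩
    · have h : F.map α ≫ F.map (eqToHom (path_len t).symm) = F.map (eqToHom (path_len s).symm) ≫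
          F.map (eqToHom (path_len s) ≫ α ≫ eqToHom (path_len t).symm) := by
        rw [← F.map_comp, ← F.map_comp, eqToHom_trans_assoc, eqToHom_refl, Category.id_comp]
      exact h.trans (congrArg (F.map _ ≫ ·) (ofPoint_map_vertexMap F α).symm)
    · refine comp_tensor_eq_comp_lift ?_ ?_
      · exact (eqToHom_map_init_assoc F (path_len (s ≫ t)) _).symm.trans
          (congrArg (F.map _ ≫ ·) (ofPoint_map_initialSegment F s t).symm)
      · exact (eqToHom_map_fin_assoc F (path_len (s ≫ t)) _).symm.trans
          (congrArg (F.map _ ≫ ·) (ofPoint_map_finalSegment F s t).symm)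

instance : (toPoint (M := M)).IsEquivalence where

end Simplicial

/-- The equivalence is inverse to `Simplicial.toPoint`, and `θ` consists of the components of
the inverse of its unit; the identities are the laws of morphisms of points for these components. -/
theorem exists_equivalence_simplicialObject (M : Type u) [Category.{v} M]
    [CartesianMonoidalCategory M] :
      ∃ (e : Point One (Base.all (MonoidalSingleObj M)) ≌
          SimplicialObject M)
        (θ : ∀ F (s : pt ⟶ pt),
          (e.functor.obj F).obj (op (SimplexCategory.mk (PathBicat.len s))) ≅ F.obj s),
        (∀ {F G} (σ : F ⟶ G) (s : pt ⟶ pt),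
          (e.functor.map σ).app _ ≫ (θ G s).hom = (θ F s).hom ≫ σ.app s) ∧
        (∀ F {s t : pt ⟶ pt} (α : s ⟶ t),
          (e.functor.obj F).map (PathBicat.vertexMap α).op ≫ (θ F t).hom =
            (θ F s).hom ≫ F.map α) ∧
        (∀ F (s t : pt ⟶ pt),
          (θ F (s ≫ t)).hom ≫ F.φ s t ≫ CartesianMonoidalCategory.fst _ _ =
            (e.functor.obj F).map (PathBicat.initialSegment s t).op ≫ (θ F s).hom) ∧
        (∀ F (s t : pt ⟶ pt),
          (θ F (s ≫ t)).hom ≫ F.φ s t ≫ CartesianMonoidalCategory.snd _ _ =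
            (e.functor.obj F).map (PathBicat.finalSegment s t).op ≫ (θ F t).hom) := by
  let e := (Simplicial.toPoint (M := M)).asEquivalence.symm
  refine ⟨e, fun F s => Point.appIso (e.unitIso.symm.app F) s, fun {F G} σ s => ?_,
    fun F {s t} α => ?_, fun F s t => ?_, fun F s t => ?_⟩
  · exact congrArg (fun ρ => Point.Hom.app ρ s) (e.unitIso.inv.naturality σ)
  · exact (e.unitIso.inv.app F).naturality α
  · exact Simplicial.comp_fst_of_lift_comp ((e.unitIso.inv.app F).app_comp s t)
  · exact Simplicial.comp_snd_of_lift_comp ((e.unitIso.inv.app F).app_comp s t)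

/-! ### The monoid of a point -/

/-- Induction on paths in `𝟏`, by adding an edge at the end. -/
lemma path_induction {P : (pt ⟶ pt) → Prop} (nil : P (𝟙 pt)) (cons : ∀ s, P s → P (s ≫ one))
    (s : pt ⟶ pt) : P s := by
  rw [← path_len s]
  induction PathBicat.len s with
  | zero => exact nil
  | succ n ih => exact cons _ ih

/-- The 2-cells between paths in `𝟏` are generated under composition and concatenation by the
cells `0 ⟶ 1` and `2 ⟶ 1`. -/
lemma cell_induction {P : ∀ {s t : pt ⟶ pt}, (s ⟶ t) → Prop}
    (hid : ∀ {s t : pt ⟶ pt} (h : s = t), P (eqToHom h))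
    (hcomp : ∀ {s t r : pt ⟶ pt} (α : s ⟶ t) (β : t ⟶ r), P α → P β → P (α ≫ β))
    (hwhisker : ∀ {s t s' t' : pt ⟶ pt} (α : s ⟶ t) (β : s' ⟶ t'), P α → P β →
      P (Bicategory.whiskerRight α s' ≫ Bicategory.whiskerLeft t β))
    (hunit : P zeroToOne) (hmul : P twoToOne) {s t : pt ⟶ pt} (α : s ⟶ t) : P α := by
  -- a 2-cell to a path of length one multiplies all edges of its domain, one after the other
  have hone : ∀ (s : pt ⟶ pt) (α : s ⟶ one), P α := by
    refine path_induction (fun α => ?_) fun s ih α => ?_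
    · rwa [Subsingleton.elim α zeroToOne]
    · let γ : s ⟶ one := cellMk ⟨fun _ => (0 : Fin 1), fun _ _ _ => le_rfl⟩
      rw [Subsingleton.elim α ((Bicategory.whiskerRight γ one ≫
        Bicategory.whiskerLeft one (𝟙 one)) ≫ twoToOne)]
      exact hcomp _ _ (hwhisker _ _ (ih γ) (by simpa using hid (rfl : one = one))) hmul
  refine path_induction (P := fun t => ∀ (s : pt ⟶ pt) (α : s ⟶ t), P α) (fun s α => ?_)
    (fun t ih s α => ?_) t s α
  · have h : PathBicat.len s = 0 := by
      by_contra h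
      exact (PathBicat.lenMap α ⟨0, Nat.pos_of_ne_zero h⟩).elim0
    obtain rfl : s = 𝟙 pt := path_ext h
    rw [show α = eqToHom rfl from cell_ext_cut fun j hj => by
      obtain rfl : j = 0 := Nat.le_zero.1 hj
      rw [cut_zero, cut_zero]]
    exact hid rfl
  · obtain ⟨p, p', rfl, β, β', rfl⟩ := exists_hcomp α
    exact hcomp _ _ (hid _) (hwhisker _ _ (ih _ β) (hone _ β'))

namespace StrongPoint

variable {M : Type u} [Category.{v} M] [MonoidalCategory M]

variable (F : Point One (Base.iso (MonoidalSingleObj M)))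

instance {A B D : PathBicat One} (s : A ⟶ B) (t : B ⟶ D) : IsIso (F.φ s t) := F.mapComp_mem s t

instance (A : PathBicat One) : IsIso (F.φ₀ A) := F.mapId_mem A

/-- The unit of the monoid of a point. -/
noncomputable def unit : 𝟙_ M ⟶ F.obj one := inv (F.φ₀ pt) ≫ F.map zeroToOne

/-- The multiplication of the monoid of a point. -/
noncomputable def mult : F.obj one ⊗ F.obj one ⟶ F.obj one := inv (F.φ one one) ≫ F.map twoToOne

lemma φ₀_unit : F.φ₀ pt ≫ unit F = F.map zeroToOne := by simp [unit]

lemma φ_mult : F.φ one one ≫ mult F = F.map twoToOne := by simp [mult]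

lemma unit_mult : unit F ▷ F.obj one ≫ mult F = (λ_ (F.obj one)).hom := by
  rw [← cancel_epi (F.φ₀ pt ▷ F.obj one), ← cancel_epi (F.φ (𝟙 pt) one), ← F.map_leftUnitor,
    ← comp_whiskerRight_assoc, φ₀_unit, ← Category.assoc, ← F.map_whiskerRight_φ, Category.assoc,
    φ_mult, ← F.map_comp]
  exact congrArg F.map (Subsingleton.elim _ _)

lemma mult_unit : F.obj one ◁ unit F ≫ mult F = (ρ_ (F.obj one)).hom := by
  rw [← cancel_epi (F.obj one ◁ F.φ₀ pt), ← cancel_epi (F.φ one (𝟙 pt)), ← F.map_rightUnitor,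
    ← whiskerLeft_comp_assoc, φ₀_unit, ← Category.assoc, ← F.map_whiskerLeft_φ, Category.assoc,
    φ_mult, ← F.map_comp]
  exact congrArg F.map (Subsingleton.elim _ _)

/-- Both sides are the image of the unique 2-cell `3 ⟶ 1`, up to colaxity isomorphisms. -/
lemma mult_assoc : mult F ▷ F.obj one ≫ mult F =
    (α_ (F.obj one) (F.obj one) (F.obj one)).hom ≫ F.obj one ◁ mult F ≫ mult F := by
  rw [← cancel_epi (F.φ one one ▷ F.obj one), ← cancel_epi (F.φ (one ≫ one) one)]
  have h₁ : F.φ (one ≫ one) one ≫ F.φ one one ▷ F.obj one ≫ mult F ▷ F.obj one ≫ mult F =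
      F.map (Bicategory.whiskerRight twoToOne one ≫ twoToOne) := by
    rw [← comp_whiskerRight_assoc, φ_mult, ← Category.assoc, ← F.map_whiskerRight_φ,
      Category.assoc, φ_mult, ← F.map_comp]
  have h₂ : F.φ (one ≫ one) one ≫ F.φ one one ▷ F.obj one ≫
      (α_ (F.obj one) (F.obj one) (F.obj one)).hom ≫ F.obj one ◁ mult F ≫ mult F =
      F.map ((Bicategory.associator one one one).hom ≫ Bicategory.whiskerLeft one twoToOne ≫
        twoToOne) := by
    have h := F.map_associator_φ one one one
    rw [← reassoc_of% h, ← whiskerLeft_comp_assoc, φ_mult]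
    rw [← Category.assoc (F.φ one (one ≫ one)), ← F.map_whiskerLeft_φ,
      Category.assoc, φ_mult, ← F.map_comp, ← F.map_comp]
  rw [h₁, h₂]
  exact congrArg F.map (Subsingleton.elim _ _)

/-- The value of a point at the path of length one is a monoid. -/
noncomputable abbrev monObj : MonObj (F.obj one) where
  one := unit F
  mul := mult F
  one_mul := unit_mult F
  mul_one := mult_unit F
  mul_assoc := mult_assoc F

variable {F} {G : Point One (Base.iso (MonoidalSingleObj M))}

lemma unit_app (σ : F ⟶ G) : unit F ≫ σ.app one = unit G := by
  rw [← cancel_epi (F.φ₀ pt), ← Category.assoc, φ₀_unit, σ.naturality, σ.app_id, Category.assoc,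
    φ₀_unit]

lemma mult_app (σ : F ⟶ G) : mult F ≫ σ.app one = (σ.app one ⊗ₘ σ.app one) ≫ mult G := by
  rw [← cancel_epi (F.φ one one), ← Category.assoc, φ_mult, σ.naturality, ← Category.assoc,
    σ.app_comp, Category.assoc, φ_mult]

variable (M) in
/-- The functor that sends a point to its monoid. -/
noncomputable def toMon : Point One (Base.iso (MonoidalSingleObj M)) ⥤ Mon M where
  obj F := { X := F.obj one, mon := monObj F }
  map {F G} σ :=
    letI := monObj F
    letI := monObj G
    { hom := σ.app one
      isMonHom_hom := ⟨unit_app σ, mult_app σ⟩ }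
  map_id _ := rfl
  map_comp _ _ := rfl

/-- The colaxity isomorphism of a point. -/
noncomputable abbrev φIso (F : Point One (Base.iso (MonoidalSingleObj M))) (s t : pt ⟶ pt) :
    F.obj (s ≫ t) ≅ F.obj s ⊗ F.obj t :=
  asIso (F.φ s t)

/-- The extension of a map between the values at the path of length one to all paths, through the
colaxity isomorphisms. The endpoint varies, as the recursion on paths demands. -/
noncomputable def extend (h : F.obj one ⟶ G.obj one) :
    ∀ {B : One} (s : Quiver.Path (⟨⟨⟩⟩ : One) B),
      F.obj (A := pt) (B := ⟨B⟩) s ⟶ G.obj (A := pt) (B := ⟨B⟩) s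
  | _, .nil => F.φ₀ pt ≫ inv (G.φ₀ pt)
  | _, .cons s _ => (φIso F s one).hom ≫ (extend h s ⊗ₘ h) ≫ (φIso G s one).inv

/-- The component of the extension at an endo-path. -/
noncomputable abbrev ext (h : F.obj one ⟶ G.obj one) (s : pt ⟶ pt) : F.obj s ⟶ G.obj s :=
  extend h s

variable (h : F.obj one ⟶ G.obj one)

lemma ext_nil_φ₀ : ext h (𝟙 pt) ≫ G.φ₀ pt = F.φ₀ pt := by
  have e : ext h (𝟙 pt) = F.φ₀ pt ≫ inv (G.φ₀ pt) := rfl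
  rw [e, Category.assoc, IsIso.inv_hom_id, Category.comp_id]

lemma ext_cons_φ (s : pt ⟶ pt) : ext h (s ≫ one) ≫ G.φ s one = F.φ s one ≫ (ext h s ⊗ₘ h) := by
  have e : ext h (s ≫ one) = F.φ s one ≫ (ext h s ⊗ₘ h) ≫ inv (G.φ s one) :=
    (rfl : _ = (φIso F s one).hom ≫ (ext h s ⊗ₘ h) ≫ (φIso G s one).inv)
  rw [e, Category.assoc, Category.assoc, IsIso.inv_hom_id, Category.comp_id]

lemma map_eqToHom_ext {s t : pt ⟶ pt} (e : s = t) :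
    F.map (eqToHom e) ≫ ext h t = ext h s ≫ G.map (eqToHom e) := by
  subst e
  simp

/-- The extension is compatible with colaxity for the concatenation of an edge by construction, and
for all concatenations by induction. -/
lemma ext_φ (s t : pt ⟶ pt) : F.φ s t ≫ (ext h s ⊗ₘ ext h t) = ext h (s ≫ t) ≫ G.φ s t := by
  revert t
  refine path_induction ?_ fun t ih => ?_
  · rw [← cancel_mono (G.obj s ◁ G.φ₀ pt), ← cancel_mono (ρ_ (G.obj s)).hom, Category.assoc,
      Category.assoc, Category.assoc, Category.assoc, ← G.map_rightUnitor,
      ← id_tensorHom, tensorHom_comp_tensorHom_assoc, ext_nil_φ₀, Category.comp_id]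
    have h₁ : (ext h s ⊗ₘ F.φ₀ pt) ≫ (ρ_ (G.obj s)).hom =
        F.obj s ◁ F.φ₀ pt ≫ (ρ_ (F.obj s)).hom ≫ ext h s := by
      rw [tensorHom_def', Category.assoc, rightUnitor_naturality]
    rw [h₁, ← Category.assoc, ← Category.assoc, Category.assoc (F.φ _ _), ← F.map_rightUnitor]
    exact map_eqToHom_ext h (Quiver.Path.comp_nil s)
  · rw [← cancel_mono (G.obj s ◁ G.φ t one),
      ← cancel_epi (F.map (Bicategory.associator s t one).hom)]
    have h₁ : F.map (Bicategory.associator s t one).hom ≫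
        (F.φ s (t ≫ one) ≫ (ext h s ⊗ₘ ext h (t ≫ one))) ≫ G.obj s ◁ G.φ t one =
        (F.φ (s ≫ t) one ≫ F.φ s t ▷ F.obj one ≫ (α_ _ _ _).hom) ≫
          (ext h s ⊗ₘ (ext h t ⊗ₘ h)) := by
      rw [← F.map_associator_φ, Category.assoc, Category.assoc, Category.assoc, ← id_tensorHom,
        tensorHom_comp_tensorHom, ext_cons_φ, Category.comp_id, ← id_tensorHom,
        tensorHom_comp_tensorHom, Category.id_comp]
    have h₂ : F.map (Bicategory.associator s t one).hom ≫ (ext h (s ≫ t ≫ one) ≫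
        G.φ s (t ≫ one)) ≫ G.obj s ◁ G.φ t one =
        ext h ((s ≫ t) ≫ one) ≫ G.φ (s ≫ t) one ≫ G.φ s t ▷ G.obj one ≫ (α_ _ _ _).hom := by
      have e : F.map (Bicategory.associator s t one).hom ≫ ext h (s ≫ t ≫ one) =
          ext h ((s ≫ t) ≫ one) ≫ G.map (Bicategory.associator s t one).hom :=
        map_eqToHom_ext h (Quiver.Path.comp_assoc s t one)
      rw [Category.assoc, reassoc_of% e, G.map_associator_φ]
    rw [h₁, h₂, reassoc_of% (ext_cons_φ h (s ≫ t)), ← tensorHom_id (G.φ s t),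
      tensorHom_comp_tensorHom_assoc, ← ih, Category.comp_id, Category.assoc, Category.assoc,
      ← associator_naturality, ← tensorHom_id, tensorHom_comp_tensorHom_assoc, Category.id_comp]

lemma ext_one : ext h one = h := by
  -- the path `𝟙 pt ≫ one` is definitionally equal to `one`, and its left unitor is an identity
  have e₁ : ext h (𝟙 pt ≫ one) ≫ G.map (Bicategory.leftUnitor one).hom =
      F.map (Bicategory.leftUnitor one).hom ≫ h := by
    rw [G.map_leftUnitor, reassoc_of% (ext_cons_φ h (𝟙 pt)), ← tensorHom_id,
      tensorHom_comp_tensorHom_assoc, ext_nil_φ₀, Category.comp_id, F.map_leftUnitor,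
      MonoidalCategory.tensorHom_def, Category.assoc, leftUnitor_naturality,
      Category.assoc, Category.assoc]
  have e₂ : ext h one ≫ G.map (𝟙 one) = F.map (𝟙 one) ≫ h := e₁
  rwa [F.map_id, G.map_id, Category.comp_id, Category.id_comp] at e₂

/-- The extension of a map compatible with units and multiplications is natural, because these
generate all 2-cells. -/
lemma ext_naturality (hunit : unit F ≫ h = unit G) (hmult : mult F ≫ h = (h ⊗ₘ h) ≫ mult G)
    {s t : pt ⟶ pt} (α : s ⟶ t) : F.map α ≫ ext h t = ext h s ≫ G.map α := by
  refine cell_induction (P := fun {s t} α => F.map α ≫ ext h t = ext h s ≫ G.map α)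
    (fun e => map_eqToHom_ext h e) (fun α β hα hβ => ?_) (fun {s t s' t'} α β hα hβ => ?_) ?_ ?_ α
  · rw [F.map_comp, G.map_comp, Category.assoc, hβ, reassoc_of% hα]
  · rw [← cancel_mono (G.φ t t'), Category.assoc, ← ext_φ, ← Category.assoc, F.map_hcomp_φ,
      Category.assoc, Category.assoc, tensorHom_comp_tensorHom, hα, hβ, G.map_hcomp_φ,
      ← Category.assoc, ← ext_φ, Category.assoc, tensorHom_comp_tensorHom]
  · rw [ext_one, ← φ₀_unit, ← φ₀_unit, Category.assoc, hunit, ← Category.assoc, ext_nil_φ₀]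
  · rw [ext_one, ← φ_mult, ← φ_mult, Category.assoc, hmult, ← Category.assoc, ← Category.assoc,
      ext_cons_φ, ext_one]

instance : (toMon M).Full where
  map_surjective {F G} f := by
    refine ⟨Point.homMk (ext f.hom)
      (ext_naturality f.hom f.isMonHom_hom.one_hom f.isMonHom_hom.mul_hom) (ext_φ f.hom)
      (ext_nil_φ₀ f.hom).symm, ?_⟩
    exact Mon.Hom.ext (ext_one f.hom)

instance : (toMon M).Faithful where
  map_injective {F G σ τ} h := by
    have h₁ : σ.app one = τ.app one := congrArg Mon.Hom.hom h
    refine Point.hom_ext (path_induction ?_ fun s ih => ?_)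
    · rw [← cancel_mono (G.φ₀ pt), ← σ.app_id, ← τ.app_id]
    · rw [← cancel_mono (G.φ s one), ← σ.app_comp, ← τ.app_comp, ih, h₁]

end StrongPoint

/-! ### Tensor powers of a monoid -/

namespace MonoidPower

/-- A cut function: a nondecreasing function that vanishes at zero. It is the map dual to a
nondecreasing map of ordinals, but without bounds on the domain and the values, so that no equality
of ordinals has to be transported. -/
structure CutFunction where
  /-- the underlying function -/
  toFun : ℕ → ℕ
  mono : Monotone toFun
  zero : toFun 0 = 0

instance : CoeFun CutFunction fun _ => ℕ → ℕ := ⟨CutFunction.toFun⟩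

/-- The cut function of a nondecreasing map. -/
def cutFunction {n m : ℕ} (u : Fin n →o Fin m) : CutFunction where
  toFun := cut u
  mono _ _ h := cut_mono u h
  zero := cut_zero u

/-- The part of a cut function after `a`. -/
def CutFunction.shift (c : CutFunction) (a : ℕ) : CutFunction where
  toFun j := c (a + j) - c a
  mono _ _ h := Nat.sub_le_sub_right (c.mono (Nat.add_le_add_left h a)) _
  zero := Nat.sub_self _

lemma CutFunction.add_eq_shift (c : CutFunction) (a j : ℕ) : c (a + j) = c a + c.shift a j :=
  (Nat.add_sub_of_le (c.mono (Nat.le_add_right a j))).symm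

/-- Composition of cut functions. -/
def CutFunction.comp (c d : CutFunction) : CutFunction where
  toFun j := c (d j)
  mono _ _ h := c.mono (d.mono h)
  zero := by rw [d.zero, c.zero]

variable {M : Type u} [Category.{v} M] [MonoidalCategory M] (A : M)

/-- The tensor power of an object, associated to the left. -/
def pow : ℕ → M
  | 0 => 𝟙_ M
  | n + 1 => pow n ⊗ A

/-- The power with no factor is the unit object. -/
def powZero : pow A 0 ≅ 𝟙_ M := Iso.refl _

/-- A power with one more factor. -/
def powSucc (n : ℕ) : pow A (n + 1) ≅ pow A n ⊗ A := Iso.refl _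

/-- The canonical isomorphism for the tensor power at a sum. -/
def powAdd (a : ℕ) : ∀ b : ℕ, pow A (a + b) ≅ pow A a ⊗ pow A b
  | 0 => (ρ_ _).symm ≪≫ whiskerLeftIso _ (powZero A).symm
  | b + 1 => powSucc A (a + b) ≪≫ whiskerRightIso (powAdd a b) A ≪≫ α_ _ _ _ ≪≫
      whiskerLeftIso _ (powSucc A b).symm

/-- The canonical isomorphism for the tensor power at a number with a decomposition as a sum. -/
def split {n a b : ℕ} (h : n = a + b) : pow A n ≅ pow A a ⊗ pow A b :=
  eqToIso (congrArg (pow A) h) ≪≫ powAdd A a b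

lemma split_succ {n a b : ℕ} (h : n = a + b) (h' : n + 1 = a + (b + 1)) :
    (split A h').hom ≫ pow A a ◁ (powSucc A b).hom =
      (powSucc A n).hom ≫ (split A h).hom ▷ A ≫ (α_ _ _ _).hom := by
  subst h
  have e : (split A h').hom = (powSucc A (a + b)).hom ≫ (split A rfl).hom ▷ A ≫ (α_ _ _ _).hom ≫
      pow A a ◁ (powSucc A b).inv := by
    simp only [split, eqToIso_refl, Iso.refl_trans]
    rfl
  rw [e]
  simp only [Category.assoc, whiskerLeft_inv_hom, Category.comp_id]

/-- The decomposition with an empty second part. -/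
lemma split_zero {n : ℕ} (h : n = n + 0) :
    (split A h).hom ≫ pow A n ◁ (powZero A).hom = (ρ_ (pow A n)).inv := by
  have e : (split A h).hom = (ρ_ (pow A n)).inv ≫ pow A n ◁ (powZero A).inv := Category.id_comp _
  rw [e, Category.assoc, whiskerLeft_inv_hom, Category.comp_id]

/-- The decomposition with an empty first part. -/
lemma split_zero_left {n : ℕ} (h : n = 0 + n) :
    (split A h).hom ≫ (powZero A).hom ▷ pow A n = (λ_ (pow A n)).inv := by
  induction n with
  | zero =>
    rw [← cancel_mono (𝟙_ M ◁ (powZero A).hom), Category.assoc, ← whisker_exchange,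
      ← Category.assoc, split_zero, ← leftUnitor_inv_naturality, unitors_inv_equal,
      ← rightUnitor_inv_naturality]
  | succ n ih =>
    rw [← cancel_mono (𝟙_ M ◁ (powSucc A n).hom), Category.assoc, ← whisker_exchange,
      ← Category.assoc, split_succ A (Nat.zero_add n).symm, ← leftUnitor_inv_naturality,
      leftUnitor_tensor_inv, ← ih (Nat.zero_add n).symm]
    simp only [Category.assoc, comp_whiskerRight, whiskerRight_tensor, Iso.hom_inv_id_assoc]

lemma split_leftUnitor {n m : ℕ} (h : n = 0 + m) (h' : n = m) :
    (split A h).hom ≫ (powZero A).hom ▷ pow A m ≫ (λ_ (pow A m)).hom =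
      eqToHom (congrArg (pow A) h') := by
  subst h'
  rw [← Category.assoc, split_zero_left, Iso.inv_hom_id, eqToHom_refl]

lemma split_rightUnitor {n m : ℕ} (h : n = m + 0) (h' : n = m) :
    (split A h).hom ≫ pow A m ◁ (powZero A).hom ≫ (ρ_ (pow A m)).hom =
      eqToHom (congrArg (pow A) h') := by
  subst h'
  rw [← Category.assoc, split_zero, Iso.inv_hom_id, eqToHom_refl]

/-- The inductive step of the coassociativity of the decompositions of powers. -/
lemma whiskerRight_associator_of_assoc {X P Q R S Y : M} {f : X ⟶ P ⊗ Y} {g : Y ⟶ Q ⊗ R}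
    {f' : X ⟶ S ⊗ R} {g' : S ⟶ P ⊗ Q} (h : f ≫ P ◁ g = f' ≫ g' ▷ R ≫ (α_ P Q R).hom) :
    f ▷ A ≫ (α_ P Y A).hom ≫ P ◁ (g ▷ A ≫ (α_ Q R A).hom) =
      f' ▷ A ≫ (α_ S R A).hom ≫ g' ▷ (R ⊗ A) ≫ (α_ P Q (R ⊗ A)).hom := by
  have h' := congrArg (· ▷ A ≫ (α_ P (Q ⊗ R) A).hom ≫ P ◁ (α_ Q R A).hom) h
  simpa using h'

/-- The coassociativity of the decompositions of powers. -/
lemma split_assoc {n a b c ab bc : ℕ} (h₁ : n = a + bc) (h₂ : bc = b + c) (h₃ : n = ab + c)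
    (h₄ : ab = a + b) : (split A h₁).hom ≫ pow A a ◁ (split A h₂).hom =
      (split A h₃).hom ≫ (split A h₄).hom ▷ pow A c ≫ (α_ _ _ _).hom := by
  induction c generalizing n bc with
  | zero =>
    obtain rfl : n = ab := h₃
    obtain rfl : bc = b := h₂
    rw [← cancel_mono (pow A a ◁ pow A bc ◁ (powZero A).hom), Category.assoc, Category.assoc,
      Category.assoc, ← MonoidalCategory.whiskerLeft_comp, split_zero,
      ← associator_naturality_right, ← whisker_exchange_assoc, ← Category.assoc, ← Category.assoc,
      split_zero]
    simp
  | succ c ih =>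
    obtain rfl : n = ab + c + 1 := h₃
    obtain rfl : bc = b + c + 1 := h₂
    have e₁ := split_succ A (by omega : ab + c = a + (b + c)) h₁
    have e₂ := split_succ A (rfl : b + c = b + c) rfl
    have e₃ := split_succ A (rfl : ab + c = ab + c) rfl
    rw [← cancel_mono (pow A a ◁ pow A b ◁ (powSucc A c).hom), Category.assoc, Category.assoc,
      Category.assoc, ← MonoidalCategory.whiskerLeft_comp, e₂,
      ← associator_naturality_right, ← whisker_exchange_assoc, reassoc_of% e₃,
      MonoidalCategory.whiskerLeft_comp, reassoc_of% e₁,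
      whiskerRight_associator_of_assoc A (ih (by omega) rfl rfl)]

lemma eqToHom_split_assoc {n n' a b c ab bc : ℕ} (h : n = n') (h₁ : n' = a + bc) (h₂ : bc = b + c)
    (h₃ : n = ab + c) (h₄ : ab = a + b) :
    eqToHom (congrArg (pow A) h) ≫ (split A h₁).hom ≫ pow A a ◁ (split A h₂).hom =
      (split A h₃).hom ≫ (split A h₄).hom ▷ pow A c ≫ (α_ _ _ _).hom := by
  subst h
  rw [eqToHom_refl, Category.id_comp, split_assoc A h₁ h₂ h₃ h₄]

section

variable [MonObj A]

/-- The iterated multiplication of a monoid. -/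
def powMul : ∀ n, pow A n ⟶ A
  | 0 => (powZero A).hom ≫ MonObj.one
  | n + 1 => (powSucc A n).hom ≫ powMul n ▷ A ≫ MonObj.mul

lemma powMul_zero : powMul A 0 = (powZero A).hom ≫ MonObj.one := rfl

lemma powMul_succ (n : ℕ) :
    powMul A (n + 1) = (powSucc A n).hom ≫ powMul A n ▷ A ≫ MonObj.mul := rfl

/-- The power with one factor. -/
def powOne : pow A 1 ≅ A := powSucc A 0 ≪≫ whiskerRightIso (powZero A) A ≪≫ λ_ A

lemma powMul_one : powMul A 1 = (powOne A).hom := by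
  rw [powMul_succ, powMul_zero, comp_whiskerRight, Category.assoc, MonObj.one_mul]
  rfl

lemma powMul_tensor_mul_zero (a : ℕ) {X : M} (f : X ⟶ pow A a ⊗ pow A 0) :
    f ≫ (powMul A a ⊗ₘ powMul A 0) ≫ MonObj.mul =
      (f ≫ pow A a ◁ (powZero A).hom) ≫ (ρ_ _).hom ≫ powMul A a := by
  rw [powMul_zero, MonoidalCategory.tensorHom_def', MonoidalCategory.whiskerLeft_comp]
  simp only [Category.assoc]
  rw [← rightUnitor_naturality, whisker_exchange_assoc, MonObj.mul_one]

/-- The general associativity law: the product of `a + b` factors is the product of the products of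
the first `a` and the last `b` factors. -/
lemma split_powMul {n a b : ℕ} (h : n = a + b) :
    (split A h).hom ≫ (powMul A a ⊗ₘ powMul A b) ≫ MonObj.mul = powMul A n := by
  induction b generalizing n with
  | zero =>
    obtain rfl : n = a := h
    rw [powMul_tensor_mul_zero, split_zero, Iso.inv_hom_id_assoc]
  | succ b ih =>
    obtain rfl : n = a + b + 1 := h
    have e : (powMul A a ⊗ₘ powMul A (b + 1)) ≫ MonObj.mul =
        pow A a ◁ (powSucc A b).hom ≫ (α_ _ _ _).inv ≫
          ((powMul A a ⊗ₘ powMul A b) ≫ MonObj.mul) ▷ A ≫ MonObj.mul := by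
      rw [powMul_succ, comp_whiskerRight, Category.assoc, MonObj.mul_assoc,
        ← tensorHom_id (powMul A a ⊗ₘ powMul A b), associator_naturality_assoc,
        Iso.inv_hom_id_assoc, tensorHom_id, ← id_tensorHom, ← id_tensorHom,
        tensorHom_comp_tensorHom_assoc, tensorHom_comp_tensorHom_assoc, Category.id_comp,
        Category.comp_id, Category.assoc]
    rw [e, reassoc_of% (split_succ A (rfl : a + b = a + b) rfl), Iso.hom_inv_id_assoc,
      ← comp_whiskerRight_assoc,
      ih rfl, powMul_succ]

/-- The map between powers of a monoid given by a cut function: the factors between consecutive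
cuts are multiplied. -/
def cutMap (c : CutFunction) : ∀ (m n : ℕ), n = c m → (pow A n ⟶ pow A m)
  | 0, _, h => eqToHom (congrArg (pow A) (h.trans c.zero))
  | m + 1, n, h =>
    (split A (show n = c m + (n - c m) by
      have := c.mono (Nat.le_add_right m 1); omega)).hom ≫
      (cutMap c m (c m) rfl ⊗ₘ powMul A (n - c m)) ≫ (powSucc A m).inv

lemma cutMap_zero (c : CutFunction) (h : 0 = c 0) : cutMap A c 0 0 h = 𝟙 _ := rfl

lemma cutMap_succ (c : CutFunction) {m n n' k : ℕ} (h : n = c (m + 1)) (h' : n' = c m)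
    (hk : n = n' + k) : cutMap A c (m + 1) n h ≫ (powSucc A m).hom =
      (split A hk).hom ≫ (cutMap A c m n' h' ⊗ₘ powMul A k) := by
  subst h'
  obtain rfl : k = n - c m := by omega
  rw [cutMap, Category.assoc, Category.assoc, Iso.inv_hom_id, Category.comp_id]

lemma cutMap_congr {c d : CutFunction} {m n : ℕ} (h : n = c m) (h' : n = d m)
    (hcd : ∀ j ≤ m, c j = d j) : cutMap A c m n h = cutMap A d m n h' := by
  induction m generalizing n with
  | zero => rfl
  | succ m ih =>
    have hm := hcd m (Nat.le_succ m)
    have hk : n = c m + (n - c m) := by have := c.mono (Nat.le_add_right m 1); omega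
    rw [← cancel_mono (powSucc A m).hom, cutMap_succ A c h rfl hk, cutMap_succ A d h' hm hk,
      ih rfl hm fun j hj => hcd j (hj.trans (Nat.le_succ m))]

lemma split_powMul_one (n : ℕ) :
    (split A (rfl : n + 1 = n + 1)).hom ≫ pow A n ◁ powMul A 1 = (powSucc A n).hom := by
  rw [powMul_one]
  change _ ≫ pow A n ◁ ((powSucc A 0).hom ≫ (powZero A).hom ▷ A ≫ (λ_ A).hom) = _
  rw [MonoidalCategory.whiskerLeft_comp, reassoc_of% (split_succ A (rfl : n = n + 0) rfl),
    MonoidalCategory.whiskerLeft_comp, ← associator_naturality_middle_assoc,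
    ← comp_whiskerRight_assoc, split_zero, triangle, inv_hom_whiskerRight, Category.comp_id]

lemma cutMap_eq_eqToHom {c : CutFunction} {m n : ℕ} (h : n = c m) (hc : ∀ j ≤ m, c j = j) :
    cutMap A c m n h = eqToHom (congrArg (pow A) (h.trans (hc m le_rfl))) := by
  obtain rfl : n = m := h.trans (hc m le_rfl)
  rw [eqToHom_refl]
  induction n with
  | zero => rfl
  | succ n ih =>
    have hn := hc n (Nat.le_succ n)
    rw [← cancel_mono (powSucc A n).hom, cutMap_succ A c h hn.symm rfl,
      ih hn.symm fun j hj => hc j (hj.trans (Nat.le_succ n)), id_tensorHom, split_powMul_one,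
      Category.id_comp]

/-- The map of a cut function that is the concatenation of two others decomposes accordingly. -/
lemma cutMap_split {c c₁ c₂ : CutFunction} {m a b n n₁ n₂ : ℕ} (hm : m = a + b)
    (h : n = c m) (h₁ : n₁ = c₁ a) (h₂ : n₂ = c₂ b) (hn : n = n₁ + n₂)
    (hc₁ : ∀ j ≤ a, c j = c₁ j) (hc₂ : ∀ j ≤ b, c (a + j) = n₁ + c₂ j) :
    cutMap A c m n h ≫ (split A hm).hom =
      (split A hn).hom ≫ (cutMap A c₁ a n₁ h₁ ⊗ₘ cutMap A c₂ b n₂ h₂) := by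
  induction b generalizing m n n₂ with
  | zero =>
    obtain rfl : m = a := hm
    obtain rfl : n₂ = 0 := h₂.trans c₂.zero
    obtain rfl : n = n₁ := hn
    rw [cutMap_zero, cutMap_congr A h h₁ hc₁, ← cancel_mono (pow A m ◁ (powZero A).hom),
      Category.assoc, split_zero, tensorHom_id, Category.assoc, ← whisker_exchange,
      reassoc_of% (split_zero A (rfl : n = n + 0)), rightUnitor_inv_naturality]
  | succ b ih =>
    obtain rfl : m = a + b + 1 := hm
    obtain ⟨k, hk⟩ : ∃ k, n₂ = c₂ b + k :=
      Nat.exists_eq_add_of_le (h₂ ▸ c₂.mono (Nat.le_succ b))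
    have hb := hc₂ b (Nat.le_succ b)
    have hk' : n = c (a + b) + k := by omega
    have IH := ih (m := a + b) (n := c (a + b)) (n₂ := c₂ b) rfl rfl rfl hb
      fun j hj => hc₂ j (hj.trans (Nat.le_succ b))
    rw [← cancel_mono (pow A a ◁ (powSucc A b).hom), Category.assoc, split_succ A rfl,
      reassoc_of% (cutMap_succ A c h rfl hk'), ← tensorHom_id, tensorHom_comp_tensorHom_assoc, IH,
      Category.comp_id, Category.assoc, ← id_tensorHom, tensorHom_comp_tensorHom, Category.comp_id,
      cutMap_succ A c₂ h₂ rfl hk]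
    have e := split_assoc A (hk'.trans (by omega)) hk hk' hb
    have e₁ : cutMap A c₁ a n₁ h₁ ⊗ₘ ((split A hk).hom ≫ (cutMap A c₂ b (c₂ b) rfl ⊗ₘ powMul A k)) =
        pow A n₁ ◁ (split A hk).hom ≫
          (cutMap A c₁ a n₁ h₁ ⊗ₘ (cutMap A c₂ b (c₂ b) rfl ⊗ₘ powMul A k)) := by
      rw [← id_tensorHom, tensorHom_comp_tensorHom, Category.id_comp]
    rw [e₁, reassoc_of% e, ← associator_naturality, ← tensorHom_id, tensorHom_comp_tensorHom_assoc,
      Category.id_comp]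

lemma cutMap_powMul (c : CutFunction) {m n : ℕ} (h : n = c m) :
    cutMap A c m n h ≫ powMul A m = powMul A n := by
  induction m generalizing n with
  | zero =>
    obtain rfl : n = 0 := h.trans c.zero
    rw [cutMap_zero, Category.id_comp]
  | succ m ih =>
    have hk : n = c m + (n - c m) := by have := c.mono (Nat.le_add_right m 1); omega
    rw [powMul_succ, reassoc_of% (cutMap_succ A c h rfl hk), ← split_powMul A hk, ← tensorHom_id,
      tensorHom_comp_tensorHom_assoc, ih, Category.comp_id]

/-- The maps of cut functions are composed contravariantly. In the inductive step, the last fibre of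
the composite is multiplied in two stages, which `cutMap_powMul` identifies with one. -/
lemma cutMap_comp (c d : CutFunction) {k m n : ℕ} (h : n = c m) (h' : m = d k) :
    cutMap A c m n h ≫ cutMap A d k m h' =
      cutMap A (c.comp d) k n (h.trans (congrArg c.toFun h')) := by
  induction k generalizing m n with
  | zero =>
    obtain rfl : m = 0 := h'.trans d.zero
    obtain rfl : n = 0 := h.trans c.zero
    exact Category.id_comp _
  | succ k ih =>
    obtain ⟨e, rfl⟩ : ∃ e, m = d k + e := Nat.exists_eq_add_of_le (h' ▸ d.mono (Nat.le_succ k))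
    have hn : n = c (d k) + c.shift (d k) e := h.trans (c.add_eq_shift _ _)
    rw [← cancel_mono (powSucc A k).hom, Category.assoc, cutMap_succ A d h' rfl rfl,
      cutMap_succ A (c.comp d) (m := k) (n' := c (d k)) _ rfl hn,
      ← Category.assoc, cutMap_split A rfl h rfl rfl hn (fun _ _ => rfl)
        (fun j _ => c.add_eq_shift _ _), Category.assoc, tensorHom_comp_tensorHom, ih,
      cutMap_powMul]

/-- The unit of the monoid of a point of powers is the original one. -/
lemma comp_powOne_of_powZero_comp {c : CutFunction} (hc : 0 = c 1) {f : 𝟙_ M ⟶ pow A 1}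
    (h : (powZero A).hom ≫ f = cutMap A c 1 0 hc) : f ≫ (powOne A).hom = MonObj.one := by
  rw [← cancel_epi (powZero A).hom, reassoc_of% h, ← powMul_one, ← powMul_zero, cutMap_powMul]

/-- The multiplication of the monoid of a point of powers is the original one. -/
lemma comp_powOne_of_split_comp {c : CutFunction} (hc : 2 = c 1)
    {f : pow A 1 ⊗ pow A 1 ⟶ pow A 1}
    (h : (split A (rfl : 2 = 1 + 1)).hom ≫ f = cutMap A c 1 2 hc) :
    f ≫ (powOne A).hom = ((powOne A).hom ⊗ₘ (powOne A).hom) ≫ MonObj.mul := by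
  rw [← cancel_epi (split A (rfl : 2 = 1 + 1)).hom, reassoc_of% h, ← powMul_one, cutMap_powMul,
    split_powMul]

end
end MonoidPower

/-! ### The point of a monoid -/

namespace MonoidPower

variable {M : Type u} [Category.{v} M] [MonoidalCategory M] (A : M) [MonObj A]

/-- The map between powers of a monoid given by a 2-cell between paths. -/
def cellMap {X Y : PathBicat One} {s t : X ⟶ Y} (α : s ⟶ t) :
    pow A (PathBicat.len s) ⟶ pow A (PathBicat.len t) :=
  cutMap A (cutFunction (PathBicat.lenMap α)) _ _ (cut_of_le _ le_rfl).symm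

lemma cellMap_eqToHom {X Y : PathBicat One} {s t : X ⟶ Y} (h : s = t) :
    cellMap A (eqToHom h) = eqToHom (congrArg (fun s => pow A (PathBicat.len s)) h) :=
  cutMap_eq_eqToHom A _ fun _ hj => cut_lenMap_eqToHom h hj

lemma cellMap_id {X Y : PathBicat One} (s : X ⟶ Y) : cellMap A (𝟙 s) = 𝟙 _ :=
  cellMap_eqToHom A rfl

lemma cellMap_comp {X Y : PathBicat One} {s t r : X ⟶ Y} (α : s ⟶ t) (β : t ⟶ r) :
    cellMap A (α ≫ β) = cellMap A α ≫ cellMap A β :=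
  (cutMap_congr A _ _ fun j _ => cut_lenMap_comp α β j).trans (cutMap_comp A _ _ _ _).symm

lemma cellMap_hcomp {X Y Z : PathBicat One} {s t : X ⟶ Y} {s' t' : Y ⟶ Z} (α : s ⟶ t)
    (β : s' ⟶ t') : cellMap A (s := s ≫ s') (t := t ≫ t') (hcomp α β) ≫
      (split A (PathBicat.len_comp t t')).hom =
        (split A (PathBicat.len_comp s s')).hom ≫ (cellMap A α ⊗ₘ cellMap A β) :=
  cutMap_split A _ _ _ _ _ (fun _ hj => cut_lenMap_hcomp_left α β hj)
    fun j _ => cut_lenMap_hcomp_right α β j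

/-- The point of a monoid: its value at a path is the tensor power whose exponent is the length. -/
def toPoint : Point One (Base.iso (MonoidalSingleObj M)) :=
  Point.mk' (fun s => pow A (PathBicat.len s)) (cellMap A)
    (fun s t => (split A (PathBicat.len_comp s t)).hom) (fun _ => (powZero A).hom)
    (cellMap_id A) (cellMap_comp A)
    (fun {_ _ _ _ _} α t => by
      rw [← tensorHom_id, ← cellMap_id]
      exact cellMap_hcomp A α (𝟙 t))
    (fun {_ _ _} s {_ _} α => by
      rw [← id_tensorHom, ← cellMap_id]
      exact cellMap_hcomp A (𝟙 s) α)
    (fun s t r => (congrArg (· ≫ _) (cellMap_eqToHom A (Quiver.Path.comp_assoc s t r))).trans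
      (eqToHom_split_assoc A (congrArg PathBicat.len (Quiver.Path.comp_assoc s t r))
        (PathBicat.len_comp s (t ≫ r)) (PathBicat.len_comp t r) (PathBicat.len_comp (s ≫ t) r)
        (PathBicat.len_comp s t)))
    (fun s => (cellMap_eqToHom A (Quiver.Path.nil_comp s)).trans
      (split_leftUnitor A (PathBicat.len_comp (𝟙 _) s)
        (congrArg PathBicat.len (Quiver.Path.nil_comp s))).symm)
    (fun s => (cellMap_eqToHom A (Quiver.Path.comp_nil s)).trans
      (split_rightUnitor A (PathBicat.len_comp s (𝟙 _))
        (congrArg PathBicat.len (Quiver.Path.comp_nil s))).symm)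
    (fun _ _ => Base.mor_of_isIso _ _)
    fun _ => Base.mor_of_isIso _ (h := (powZero A).isIso_hom) _

end MonoidPower

namespace StrongPoint

open MonoidPower

variable {M : Type u} [Category.{v} M] [MonoidalCategory M]

instance : (toMon M).EssSurj where
  mem_essImage A := by
    refine ⟨toPoint A.X, ⟨Mon.mkIso (powOne A.X) ?_ ?_⟩⟩
    · exact comp_powOne_of_powZero_comp A.X (c := cutFunction (PathBicat.lenMap zeroToOne))
        (cut_of_le (PathBicat.lenMap zeroToOne) (le_refl 1)).symm (φ₀_unit (toPoint A.X))
    · exact comp_powOne_of_split_comp A.X (c := cutFunction (PathBicat.lenMap twoToOne))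
        (cut_of_le (PathBicat.lenMap twoToOne) (le_refl 1)).symm (φ_mult (toPoint A.X))

instance : (toMon M).IsEquivalence where

end StrongPoint

open StrongPoint in
/-- The equivalence is `StrongPoint.toMon`, so that `θ` can be the identity. -/
theorem exists_equivalence_mon (M : Type u) [Category.{v} M] [MonoidalCategory M] :
      ∃ (e : Point One (Base.iso (MonoidalSingleObj M)) ≌ Mon M)
        (θ : ∀ F, (e.functor.obj F).X ≅ F.obj one),
        (∀ {F G} (σ : F ⟶ G),
          (e.functor.map σ).hom ≫ (θ G).hom = (θ F).hom ≫ σ.app one) ∧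
        (∀ F, F.φ₀ pt ≫ (e.functor.obj F).mon.one ≫ (θ F).hom = F.map zeroToOne) ∧
        (∀ F, F.φ one one ≫ ((θ F).inv ⊗ₘ (θ F).inv) ≫
          (e.functor.obj F).mon.mul ≫ (θ F).hom = F.map twoToOne) := by
  refine ⟨(toMon M).asEquivalence, fun F => Iso.refl _, fun σ => ?_, fun F => ?_, fun F => ?_⟩
  · exact (Category.comp_id _).trans (Category.id_comp _).symm
  · exact (congrArg (F.φ₀ pt ≫ ·) (Category.comp_id _)).trans (φ₀_unit F)
  · refine Eq.trans ?_ (φ_mult F)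
    refine congrArg (F.φ one one ≫ ·) ?_
    change (𝟙 (F.obj one) ⊗ₘ 𝟙 (F.obj one)) ≫ mult F ≫ 𝟙 (F.obj one) = mult F
    rw [id_tensorHom_id, Category.id_comp, Category.comp_id]

end SegalPath

theorem mainTheorem4 :
    -- (i) 1-points of `(M, Iso(M))` and monoids
    (∀ (M : Type u) [Category.{v} M] [MonoidalCategory M],
      ∃ (e : SegalPath.Point SegalPath.One (SegalPath.Base.iso (MonoidalSingleObj M)) ≌ Mon M)
        (θ : ∀ F, (e.functor.obj F).X ≅ F.obj SegalPath.one),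
        (∀ {F G} (σ : F ⟶ G),
          (e.functor.map σ).hom ≫ (θ G).hom = (θ F).hom ≫ σ.app SegalPath.one) ∧
        (∀ F, F.φ₀ SegalPath.pt ≫ (e.functor.obj F).mon.one ≫ (θ F).hom =
          F.map SegalPath.zeroToOne) ∧
        (∀ F, F.φ SegalPath.one SegalPath.one ≫ ((θ F).inv ⊗ₘ (θ F).inv) ≫
          (e.functor.obj F).mon.mul ≫ (θ F).hom = F.map SegalPath.twoToOne)) ∧
    -- (ii) 1-points of `(M, W)` and homotopy monoids
    (∀ (M : Type u) [Category.{v} M] [MonoidalCategory M]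
      (W : SegalPath.Base (MonoidalSingleObj M)),
      ∃ (e : SegalPath.Point SegalPath.One W ≌ SegalPath.HomotopyMonoid W)
        (θ : ∀ (F : SegalPath.Point SegalPath.One W) (s : SegalPath.pt ⟶ SegalPath.pt),
          (e.functor.obj F).Y.obj ((SegalPath.PathBicat.length _ _).obj s) ≅ F.obj s),
        (∀ {F G} (σ : F ⟶ G) (s : SegalPath.pt ⟶ SegalPath.pt),
          (e.functor.map σ).τ.app _ ≫ (θ G s).hom = (θ F s).hom ≫ σ.app s) ∧
        (∀ F {s t : SegalPath.pt ⟶ SegalPath.pt} (α : s ⟶ t),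
          (e.functor.obj F).Y.map ((SegalPath.PathBicat.length _ _).map α) ≫ (θ F t).hom =
            (θ F s).hom ≫ F.map α) ∧
        (∀ F (s t : SegalPath.pt ⟶ SegalPath.pt),
          (e.functor.obj F).Y.map (eqToHom (SegalPath.PathBicat.length_comp s t)) ≫
              Functor.OplaxMonoidal.δ (e.functor.obj F).Y _ _ ≫ ((θ F s).hom ⊗ₘ (θ F t).hom) =
            (θ F (s ≫ t)).hom ≫ F.φ s t) ∧
        (∀ F, (e.functor.obj F).Y.map (eqToHom (SegalPath.PathBicat.length_id SegalPath.pt)) ≫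
              Functor.OplaxMonoidal.η (e.functor.obj F).Y =
            (θ F (𝟙 SegalPath.pt)).hom ≫ F.φ₀ SegalPath.pt)) ∧
    -- (iii) 1-points of `(M, Mor(M))` for a cartesian `M` and simplicial objects
    (∀ (M : Type u) [Category.{v} M] [CartesianMonoidalCategory M],
      ∃ (e : SegalPath.Point SegalPath.One (SegalPath.Base.all (MonoidalSingleObj M)) ≌
          SimplicialObject M)
        (θ : ∀ F (s : SegalPath.pt ⟶ SegalPath.pt),
          (e.functor.obj F).obj (op (SimplexCategory.mk (SegalPath.PathBicat.len s))) ≅ F.obj s),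
        (∀ {F G} (σ : F ⟶ G) (s : SegalPath.pt ⟶ SegalPath.pt),
          (e.functor.map σ).app _ ≫ (θ G s).hom = (θ F s).hom ≫ σ.app s) ∧
        (∀ F {s t : SegalPath.pt ⟶ SegalPath.pt} (α : s ⟶ t),
          (e.functor.obj F).map (SegalPath.PathBicat.vertexMap α).op ≫ (θ F t).hom =
            (θ F s).hom ≫ F.map α) ∧
        (∀ F (s t : SegalPath.pt ⟶ SegalPath.pt),
          (θ F (s ≫ t)).hom ≫ F.φ s t ≫ CartesianMonoidalCategory.fst _ _ =
            (e.functor.obj F).map (SegalPath.PathBicat.initialSegment s t).op ≫ (θ F s).hom) ∧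
        (∀ F (s t : SegalPath.pt ⟶ SegalPath.pt),
          (θ F (s ≫ t)).hom ≫ F.φ s t ≫ CartesianMonoidalCategory.snd _ _ =
            (e.functor.obj F).map (SegalPath.PathBicat.finalSegment s t).op ≫ (θ F t).hom)) :=
  ⟨fun M _ _ => SegalPath.exists_equivalence_mon M,
    fun _ _ _ W => SegalPath.exists_equivalence_homotopyMonoid W,
    fun M _ _ => SegalPath.exists_equivalence_simplicialObject M⟩
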